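/- Let $k_1,k_2,m_1,m_2\ge 0$ be integers with $k_1+k_2\ge 1$, put $n_j=2m_j+1$, and regard $\mathbb S^{n_j}$ as the unit sphere of $\mathbb C^{m_j+1}$. For $j=1,2$ let $M_j$ be a smooth manifold of dimension $k_j$ and let $f_j:M_j\to\mathbb S^{n_j}$ be a smooth minimal immersion (an immersion whose mean curvature vector in the sphere vanishes) that is $\mathcal C$-totally real, i.e. the vector field $x\mapsto i\cdot f_j(x)$ along $f_j$ is normal to $f_j$. For a curve $\gamma=(\gamma_1,\gamma_2):\mathbb R\to\mathbb S^3\subset\mathbb C^2$ put $$G_\gamma:\mathbb R\times M_1\times M_2\to\mathbb S^{n_1+n_2+1}\subset\mathbb C^{m_1+1}\oplus\mathbb C^{m_2+1},\qquad G_\gamma(t,x,y)=\big(\gamma_1(t)f_1(x),\,\gamma_2(t)f_2(y)\big).$$ A generating curve is a smooth immersed curve $\gamma:\mathbb R\to\mathbb S^3$ of infinite length in both directions whose components $\gamma_1,\gamma_2$ have no zeros. When $G_\gamma$ is a minimal immersion it is called a spiral minimal product. It is of steady magnitudes if $|\gamma_1|$ and $|\gamma_2|$ are constant, and of varying magnitudes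 otherwise. It is doubly spiral if neither of the arguments of $\gamma_1,\gamma_2$ is constant, and singly spiral if exactly one of them is constant. Two curves are called congruent if their traces in $\mathbb C\oplus\mathbb C$ are mapped onto each other by a map $A\times B$ with $A,B$ real-linear isometries of $\mathbb C$; in particular, reparametrizing a curve, or rotating its two components separately, gives a congruent curve. Then, for each of the following three types, there are uncountably many pairwise non-congruent generating curves $\gamma$ for which $G_\gamma$ is a minimal immersion of that type: 1. doubly spiral minimal products of steady magnitudes; 2. doubly spiral minimal products of varying magnitudes; 3. singly spiral minimal products of varying magnitudes. -/

import Mathlib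

open scoped Manifold ContDiff

noncomputable section

/-! ### Minimal immersions into unit spheres

`E` is a finite-dimensional Euclidean space and its unit sphere is the ambient manifold.
A map into the sphere is regarded as a map into `E` whose values have norm one. -/

section Sphere

variable {V : Type*} [NormedAddCommGroup V] [NormedSpace ℝ V] [FiniteDimensional ℝ V]
variable {E : Type*} [NormedAddCommGroup E] [InnerProductSpace ℝ E]

/-- The matrix of the metric that a (local) parametrization `F` induces at `x`. -/
def firstFundamentalForm (F : V → E) (x : V) :
    Matrix (Fin (Module.finrank ℝ V)) (Fin (Module.finrank ℝ V)) ℝ :=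
  Matrix.of fun i j =>
    inner ℝ (fderiv ℝ F x (Module.finBasis ℝ V i)) (fderiv ℝ F x (Module.finBasis ℝ V j))

/-- The normal space at `x`, inside the tangent space of the unit sphere at `F x`, of a
parametrized spherical submanifold `F`: the vectors orthogonal to all tangent vectors of `F`
and to the position vector `F x`. -/
def sphereNormalSpace (F : V → E) (x : V) : Submodule ℝ E :=
  ((fderiv ℝ F x).toLinearMap.range ⊔ Submodule.span ℝ {F x})ᗮ

variable [FiniteDimensional ℝ E]

/-- The second fundamental form in the unit sphere: the normal part of the second derivative. -/
def secondFundamentalForm (F : V → E) (x v w : V) : E :=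
  (sphereNormalSpace F x).starProjection (fderiv ℝ (fderiv ℝ F) x v w)

/-- The mean curvature vector in the unit sphere: the trace of the second fundamental form with
respect to the induced metric. -/
def meanCurvatureVector (F : V → E) (x : V) : E :=
  ∑ i, ∑ j, (firstFundamentalForm F x)⁻¹ i j •
    secondFundamentalForm F x (Module.finBasis ℝ V i) (Module.finBasis ℝ V j)

variable {H : Type*} [TopologicalSpace H] {M : Type*} [TopologicalSpace M] [ChartedSpace H M]

/-- `f` is a smooth minimal immersion of `M` (a manifold without boundary, modelled by `I`) into
the unit sphere of `E`. The mean curvature vector at `p` is computed in the chart at `p`; it does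
not depend on the chart. -/
structure IsMinimalSphericalImmersion (I : ModelWithCorners ℝ V H) (f : M → E) : Prop where
  norm_eq_one : ∀ p, ‖f p‖ = 1
  contMDiff : ContMDiff I 𝓘(ℝ, E) ∞ f
  mfderiv_injective : ∀ p, Function.Injective (mfderiv I 𝓘(ℝ, E) f p)
  meanCurvature_eq_zero : ∀ p,
    meanCurvatureVector (f ∘ (extChartAt I p).symm) (extChartAt I p p) = 0

end Sphere

/-- The immersion `f` into the unit sphere of `ℂ^(m+1)` is `𝒞`-totally real: the vector field
`i · f` along `f` is normal to `f`. -/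
def IsCTotallyReal {V : Type*} [NormedAddCommGroup V] [NormedSpace ℝ V]
    {H : Type*} [TopologicalSpace H] {M : Type*} [TopologicalSpace M] [ChartedSpace H M]
    {m : ℕ} (I : ModelWithCorners ℝ V H) (f : M → EuclideanSpace ℂ (Fin (m + 1))) : Prop :=
  ∀ (p : M) (v : TangentSpace I p),
    inner ℝ (Complex.I • f p)
      (mfderiv I 𝓘(ℝ, EuclideanSpace ℂ (Fin (m + 1))) f p v : EuclideanSpace ℂ (Fin (m + 1))) = 0

/-- The `γ`-product `(t, x, y) ↦ (γ₁(t) f₁(x), γ₂(t) f₂(y))`, as a map to the Euclidean space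
`ℂ^(m₁+1) ⊕ ℂ^(m₂+1)`. -/
def gammaProduct {M₁ M₂ : Type*} {m₁ m₂ : ℕ} (γ : ℝ → ℂ × ℂ)
    (f₁ : M₁ → EuclideanSpace ℂ (Fin (m₁ + 1))) (f₂ : M₂ → EuclideanSpace ℂ (Fin (m₂ + 1))) :
    ℝ × M₁ × M₂ →
      WithLp 2 (EuclideanSpace ℂ (Fin (m₁ + 1)) × EuclideanSpace ℂ (Fin (m₂ + 1))) :=
  fun q => WithLp.toLp 2 ((γ q.1).1 • f₁ q.2.1, (γ q.1).2 • f₂ q.2.2)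

/-! ### Generating curves -/

/-- The Euclidean speed of a curve in `ℂ²`. -/
def speed (γ : ℝ → ℂ × ℂ) (t : ℝ) : ℝ :=
  Real.sqrt (‖(deriv γ t).1‖ ^ 2 + ‖(deriv γ t).2‖ ^ 2)

/-- A smooth immersed curve in `S³ ⊂ ℂ²`, defined on `ℝ`, both of whose components have an
argument (are nowhere zero), and which has infinite length in both directions. The last condition
says that the curve is global, not a reparametrized short piece. -/
structure IsGeneratingCurve (γ : ℝ → ℂ × ℂ) : Prop where
  contDiff : ContDiff ℝ ∞ γ
  mem_sphere : ∀ t, ‖(γ t).1‖ ^ 2 + ‖(γ t).2‖ ^ 2 = 1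
  deriv_ne_zero : ∀ t, deriv γ t ≠ 0
  fst_ne_zero : ∀ t, (γ t).1 ≠ 0
  snd_ne_zero : ∀ t, (γ t).2 ≠ 0
  length_atTop : Filter.Tendsto (fun T => ∫ t in (0 : ℝ)..T, speed γ t) Filter.atTop Filter.atTop
  length_atBot : Filter.Tendsto (fun T => ∫ t in (-T)..(0 : ℝ), speed γ t)
    Filter.atTop Filter.atTop

/-- The magnitudes `|γ₁|` and `|γ₂|` remain unchanged. -/
def SteadyMagnitudes (γ : ℝ → ℂ × ℂ) : Prop :=
  (∀ t t', ‖(γ t).1‖ = ‖(γ t').1‖) ∧ (∀ t t', ‖(γ t).2‖ = ‖(γ t').2‖)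

/-- The argument of `z` is constant (used for nowhere zero `z`). -/
def ConstantArgument (z : ℝ → ℂ) : Prop := ∀ t t', (z t).arg = (z t').arg

/-- Neither argument is constant. -/
def DoublySpiral (γ : ℝ → ℂ × ℂ) : Prop :=
  ¬ ConstantArgument (fun t => (γ t).1) ∧ ¬ ConstantArgument (fun t => (γ t).2)

/-- Exactly one argument is constant. -/
def SinglySpiral (γ : ℝ → ℂ × ℂ) : Prop :=
  Xor (ConstantArgument (fun t => (γ t).1)) (ConstantArgument (fun t => (γ t).2))

/-- The traces of two curves agree up to isometries of the two factors of `ℂ ⊕ ℂ`. In particular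
reparametrizing a curve, or rotating its components, gives a congruent curve. -/
def CongruentCurves (γ γ' : ℝ → ℂ × ℂ) : Prop :=
  ∃ A B : ℂ ≃ₗᵢ[ℝ] ℂ, Prod.map A B '' Set.range γ = Set.range γ'

/-- Uncountably many pairwise non-congruent curves have the property `P`. -/
def UncountablyManyCurves (P : (ℝ → ℂ × ℂ) → Prop) : Prop :=
  ∃ S : Set (ℝ → ℂ × ℂ), ¬ S.Countable ∧ (∀ γ ∈ S, P γ) ∧
    S.Pairwise fun γ γ' => ¬ CongruentCurves γ γ'

/-- `γ` is a generating curve for which the `γ`-product of `f₁` and `f₂` is a minimal immersion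
of `ℝ × M₁ × M₂` into the unit sphere of `ℂ^(m₁+1) ⊕ ℂ^(m₂+1)`. -/
def GeneratesSpiralMinimalProduct (k₁ k₂ : ℕ) {m₁ m₂ : ℕ}
    {M₁ : Type*} [TopologicalSpace M₁] [ChartedSpace (EuclideanSpace ℝ (Fin k₁)) M₁]
    {M₂ : Type*} [TopologicalSpace M₂] [ChartedSpace (EuclideanSpace ℝ (Fin k₂)) M₂]
    (f₁ : M₁ → EuclideanSpace ℂ (Fin (m₁ + 1))) (f₂ : M₂ → EuclideanSpace ℂ (Fin (m₂ + 1)))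
    (γ : ℝ → ℂ × ℂ) : Prop :=
  IsGeneratingCurve γ ∧
    IsMinimalSphericalImmersion (𝓘(ℝ, ℝ).prod ((𝓡 k₁).prod (𝓡 k₂))) (gammaProduct γ f₁ f₂)

end

/-! Because the factors are `𝒞`-totally real, the `t`-direction of the product is orthogonal to the
directions of `M₁` and `M₂`. Minimality of the factors then reduces minimality of the product to a
condition on `γ` alone: it suffices that `γ` is a geodesic of `S³` for the weighted metric
`|γ₁|^(2k₁) |γ₂|^(2k₂) |dγ|²` (`meanCurvatureVector_smulProduct`,
`isMinimalSphericalImmersion_gammaProduct`).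

When `|γ'|²` equals the weight `|γ₁|^(2k₁) |γ₂|^(2k₂)`, the geodesic equation reads `γⱼ'' = |γ'|²
(kⱼ / |γⱼ|² - c) γⱼ` with `c = k₁ + k₂ + 1`. The force on each component is central, so there are
two conserved angular momenta `J₁`, `J₂`, and `r = |γ₁|²` moves like a particle on a line: `r'² = 4
Φ(r)` and `r'' = 2 Φ'(r)`. Conversely, every such `r` with values in `(0, 1)` rebuilds a suitable
curve, provided that `J₁`, `J₂` are not both zero (`generatesSpiralMinimalProduct_spiralCurve`).

Start with `r' = 0` at `r₀`, giving the first component the share `u` of the squared speed. Then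
`Φ(r₀) = 0`, and `Φ'(r₀)` has the sign of `u + k₁ - (k₁ + k₂ + 1) r₀`. If this is zero, `r` is
constant: steady magnitudes. If it is positive, `r` is not constant and stays between `r₀` and a
bound below `1` (`exists_oscillation`): varying magnitudes. The first argument is constant exactly
for `u = 0`, the second exactly for `u = 1`.

The minimum `r₀` of `|γ₁|²` is a congruence invariant and may range over an interval, whence
uncountably many classes (`uncountablyManyCurves_of_isLeast`). -/

noncomputable section

/-! ### Mean curvature as the normal part of a trace over an orthonormal frame. -/

section MeanCurvature

variable {V : Type*} [NormedAddCommGroup V] [NormedSpace ℝ V] [FiniteDimensional ℝ V]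
variable {E : Type*} [NormedAddCommGroup E] [InnerProductSpace ℝ E]

/-- The inverse of the first fundamental form in terms of a family which is orthonormal for the
induced metric. -/
theorem firstFundamentalForm_inv_eq_sum {ι : Type*} [Fintype ι] [DecidableEq ι] (F : V → E) (x : V)
    (hcard : Fintype.card ι = Module.finrank ℝ V) (e : ι → V)
    (he : ∀ a b, inner ℝ (fderiv ℝ F x (e a)) (fderiv ℝ F x (e b)) = if a = b then (1 : ℝ) else 0)
    (i j : Fin (Module.finrank ℝ V)) :
    (firstFundamentalForm F x)⁻¹ i j =
      ∑ a, (Module.finBasis ℝ V).repr (e a) i * (Module.finBasis ℝ V).repr (e a) j := by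
  let A : Matrix ι (Fin (Module.finrank ℝ V)) ℝ :=
    Matrix.of fun a i => (Module.finBasis ℝ V).repr (e a) i
  have h1 : A * (firstFundamentalForm F x * A.transpose) = 1 := by
    ext a b
    have hexp : ∀ a, fderiv ℝ F x (e a) = ∑ i, A a i • fderiv ℝ F x (Module.finBasis ℝ V i) := by
      intro a
      conv_lhs => rw [← (Module.finBasis ℝ V).sum_repr (e a)]
      simp only [A, map_sum, map_smul, Matrix.of_apply]
    have := he a b
    rw [hexp a, hexp b] at this
    simp only [sum_inner, inner_sum, inner_smul_left, inner_smul_right] at this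
    rw [Matrix.one_apply, ← this, ← Matrix.mul_assoc, Matrix.mul_apply]
    refine Finset.sum_congr rfl fun i _ => ?_
    rw [Matrix.mul_apply, Finset.sum_mul, Finset.mul_sum]
    refine Finset.sum_congr rfl fun j _ => ?_
    simp only [firstFundamentalForm, Matrix.of_apply, Matrix.transpose_apply, conj_trivial]
    ring
  -- `A` is square up to reindexing, so `A (G Aᵀ) = 1` can be commuted to `G (Aᵀ A) = 1`, which
  -- exhibits `Aᵀ A` as the inverse of the metric matrix `G`.
  rw [Matrix.mul_eq_one_comm_of_card_eq _ _ _ (by simpa using hcard), Matrix.mul_assoc] at h1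
  rw [Matrix.inv_eq_right_inv h1, Matrix.mul_apply]
  rfl

variable [FiniteDimensional ℝ E]

theorem meanCurvatureVector_eq_starProjection {ι : Type*} [Fintype ι] [DecidableEq ι] (F : V → E)
    (x : V) (hcard : Fintype.card ι = Module.finrank ℝ V) (e : ι → V)
    (he : ∀ a b, inner ℝ (fderiv ℝ F x (e a)) (fderiv ℝ F x (e b)) = if a = b then (1 : ℝ) else 0) :
    meanCurvatureVector F x =
      (sphereNormalSpace F x).starProjection (∑ a, fderiv ℝ (fderiv ℝ F) x (e a) (e a)) := by
  have hexp : ∀ a, fderiv ℝ (fderiv ℝ F) x (e a) (e a) = ∑ i, ∑ j,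
      ((Module.finBasis ℝ V).repr (e a) i * (Module.finBasis ℝ V).repr (e a) j) •
        fderiv ℝ (fderiv ℝ F) x (Module.finBasis ℝ V i) (Module.finBasis ℝ V j) := by
    intro a
    conv_lhs => rw [← (Module.finBasis ℝ V).sum_repr (e a)]
    simp only [map_sum, map_smul, _root_.sum_apply, _root_.smul_apply,
      Finset.smul_sum, smul_smul]
    rw [Finset.sum_comm]
    refine Finset.sum_congr rfl fun i _ => Finset.sum_congr rfl fun j _ => ?_
    rw [mul_comm]
  simp only [hexp]
  rw [Finset.sum_comm]
  simp only [meanCurvatureVector, secondFundamentalForm, map_sum, map_smul]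
  refine Finset.sum_congr rfl fun i _ => ?_
  rw [Finset.sum_comm]
  refine Finset.sum_congr rfl fun j _ => ?_
  rw [firstFundamentalForm_inv_eq_sum F x hcard e he, Finset.sum_smul]

omit [FiniteDimensional ℝ E] in
theorem exists_orthonormal_fderiv (F : V → E) (x : V)
    (hinj : Function.Injective (fderiv ℝ F x)) :
    ∃ e : Fin (Module.finrank ℝ V) → V, ∀ a b,
      inner ℝ (fderiv ℝ F x (e a)) (fderiv ℝ F x (e b)) = if a = b then (1 : ℝ) else 0 := by
  have hfr : Module.finrank ℝ (fderiv ℝ F x).toLinearMap.range = Module.finrank ℝ V :=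
    LinearMap.finrank_range_of_inj hinj
  let b := (stdOrthonormalBasis ℝ (fderiv ℝ F x).toLinearMap.range).reindex (finCongr hfr)
  have hb : ∀ a, ∃ v, fderiv ℝ F x v = b a := fun a => (b a).2
  choose e he using hb
  refine ⟨e, fun i j => ?_⟩
  rw [he, he, ← Submodule.coe_inner]
  exact orthonormal_iff_ite.1 b.orthonormal i j

omit [FiniteDimensional ℝ V] [FiniteDimensional ℝ E] in
theorem eventually_hasDerivAt_line {F : V → E} {x : V} (hF : ContDiffAt ℝ 2 F x) (v : V) :
    ∀ᶠ s in nhds (0 : ℝ),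
      HasDerivAt (fun s : ℝ => F (x + s • v)) (fderiv ℝ F (x + s • v) v) s := by
  have h1 : ∀ᶠ y in nhds x, DifferentiableAt ℝ F y := by
    filter_upwards [hF.eventually (by simp)] with y hy
    exact hy.differentiableAt (by norm_num)
  have hc : Filter.Tendsto (fun s : ℝ => x + s • v) (nhds 0) (nhds x) := by
    have : Continuous fun s : ℝ => x + s • v := by fun_prop
    simpa using this.tendsto 0
  filter_upwards [hc.eventually h1] with s hs
  have h2 : HasDerivAt (fun s : ℝ => x + s • v) v s := by
    simpa using ((hasDerivAt_id s).smul_const v).const_add x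
  exact hs.hasFDerivAt.comp_hasDerivAt s h2

omit [FiniteDimensional ℝ V] [FiniteDimensional ℝ E] in
theorem hasDerivAt_fderiv_line {F : V → E} {x : V} (hF : ContDiffAt ℝ 2 F x) (v : V) :
    HasDerivAt (fun s : ℝ => fderiv ℝ F (x + s • v) v) (fderiv ℝ (fderiv ℝ F) x v v) 0 := by
  have h1 : DifferentiableAt ℝ (fderiv ℝ F) x :=
    (hF.fderiv_right (m := 1) (by norm_num)).differentiableAt (by norm_num)
  have h2 : HasDerivAt (fun s : ℝ => x + s • v) v 0 := by
    simpa using ((hasDerivAt_id (0 : ℝ)).smul_const v).const_add x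
  have h3 : HasFDerivAt (fderiv ℝ F) (fderiv ℝ (fderiv ℝ F) x) (x + (0 : ℝ) • v) := by
    simpa using h1.hasFDerivAt
  have h4 := h3.comp_hasDerivAt (0 : ℝ) h2
  exact (h4.clm_apply (hasDerivAt_const (0 : ℝ) v)).congr_deriv (by simp)

omit [FiniteDimensional ℝ V] [FiniteDimensional ℝ E] in
/-- The second derivative in the direction `v`, computed along the line in this direction. -/
theorem fderiv_fderiv_eq_of_line {F : V → E} {x : V} (hF : ContDiffAt ℝ 2 F x) (v : V)
    {g' : ℝ → E} {g'' : E}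
    (h1 : ∀ᶠ s in nhds (0 : ℝ), HasDerivAt (fun s : ℝ => F (x + s • v)) (g' s) s)
    (h2 : HasDerivAt g' g'' 0) : fderiv ℝ (fderiv ℝ F) x v v = g'' := by
  refine (hasDerivAt_fderiv_line hF v).unique (h2.congr_of_eventuallyEq ?_)
  filter_upwards [h1, eventually_hasDerivAt_line hF v] with s hs hs'
  exact hs'.unique hs

omit [FiniteDimensional ℝ V] [FiniteDimensional ℝ E] in
theorem inner_fderiv_eq_zero_of_norm_eq_one {F : V → E} (hn : ∀ y, ‖F y‖ = 1) {x : V}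
    (hF : DifferentiableAt ℝ F x) (v : V) : inner ℝ (F x) (fderiv ℝ F x v) = 0 := by
  have h2 : HasDerivAt (fun s : ℝ => x + s • v) v 0 := by
    simpa using ((hasDerivAt_id (0 : ℝ)).smul_const v).const_add x
  have hF' : HasFDerivAt F (fderiv ℝ F x) (x + (0 : ℝ) • v) := by simpa using hF.hasFDerivAt
  have h3 := hF'.comp_hasDerivAt (0 : ℝ) h2
  have h4 := (h3.inner ℝ h3).unique (f := fun _ : ℝ => _)
    ((hasDerivAt_const (0 : ℝ) (1 : ℝ)).congr_of_eventuallyEq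
      (Filter.Eventually.of_forall fun s => by
        simp [hn]))
  simp only [Function.comp, zero_smul, add_zero] at h4
  rw [real_inner_comm (F x)] at h4
  linarith

omit [FiniteDimensional ℝ V] [FiniteDimensional ℝ E] in
theorem inner_fderiv_fderiv_of_norm_eq_one {F : V → E} (hn : ∀ y, ‖F y‖ = 1) {x : V}
    (hF : ContDiffAt ℝ 2 F x) (v : V) :
    inner ℝ (F x) (fderiv ℝ (fderiv ℝ F) x v v) = - ‖fderiv ℝ F x v‖ ^ 2 := by
  have hc : Filter.Tendsto (fun s : ℝ => x + s • v) (nhds 0) (nhds x) := by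
    have : Continuous fun s : ℝ => x + s • v := by fun_prop
    simpa using this.tendsto 0
  have h1 : ∀ᶠ y in nhds x, DifferentiableAt ℝ F y := by
    filter_upwards [hF.eventually (by simp)] with y hy
    exact hy.differentiableAt (by norm_num)
  have h3 := (eventually_hasDerivAt_line hF v).self_of_nhds
  have h4 := ((h3.inner ℝ (hasDerivAt_fderiv_line hF v))).unique
    ((hasDerivAt_const (0 : ℝ) (0 : ℝ)).congr_of_eventuallyEq (by
      filter_upwards [hc.eventually h1] with s hs
      exact inner_fderiv_eq_zero_of_norm_eq_one hn hs v))
  simp only [zero_smul, add_zero, real_inner_self_eq_norm_sq] at h4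
  linarith

/-- For a minimal parametrization the trace of the second derivative is, up to a tangent vector,
`-dim V` times the position vector. -/
theorem exists_sum_fderiv_fderiv_eq {F : V → E} (hn : ∀ y, ‖F y‖ = 1) {x : V}
    (hF : ContDiffAt ℝ 2 F x) (hmin : meanCurvatureVector F x = 0)
    (e : Fin (Module.finrank ℝ V) → V)
    (he : ∀ a b, inner ℝ (fderiv ℝ F x (e a)) (fderiv ℝ F x (e b)) = if a = b then (1 : ℝ) else 0) :
    ∃ w, ∑ a, fderiv ℝ (fderiv ℝ F) x (e a) (e a) =
      fderiv ℝ F x w - (Module.finrank ℝ V : ℝ) • F x := by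
  rw [meanCurvatureVector_eq_starProjection F x (by simp) e he,
    Submodule.starProjection_apply_eq_zero_iff, sphereNormalSpace,
    Submodule.orthogonal_orthogonal, Submodule.mem_sup] at hmin
  obtain ⟨y, ⟨w, rfl⟩, z, hz, hsum⟩ := hmin
  obtain ⟨c, rfl⟩ := Submodule.mem_span_singleton.1 hz
  -- Vanishing normal part leaves a tangent vector plus `c • F x`; pairing with `F x` determines
  -- `c`, since each frame vector contributes `-1`.
  have h1 : inner ℝ (F x) (∑ a, fderiv ℝ (fderiv ℝ F) x (e a) (e a)) =
      -(Module.finrank ℝ V : ℝ) := by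
    rw [inner_sum]
    simp only [inner_fderiv_fderiv_of_norm_eq_one hn hF, ← real_inner_self_eq_norm_sq, he]
    simp
  have h2 := inner_fderiv_eq_zero_of_norm_eq_one hn (hF.differentiableAt (by norm_num)) w
  rw [← hsum, inner_add_right, inner_smul_right, real_inner_self_eq_norm_sq, hn] at h1
  simp only [ContinuousLinearMap.coe_coe] at h1 hsum
  refine ⟨w, ?_⟩
  have hc : c = -(Module.finrank ℝ V : ℝ) := by linarith
  rw [← hsum, hc, neg_smul, sub_eq_add_neg]

end MeanCurvature

/-! ### Complex multiples and the real inner product. -/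

section ComplexStructure

variable {E : Type*} [NormedAddCommGroup E] [InnerProductSpace ℝ E] [NormedSpace ℂ E]

theorem inner_I_smul_I_smul [IsScalarTower ℝ ℂ E] (v w : E) :
    inner ℝ (Complex.I • v) (Complex.I • w) = inner ℝ v w := by
  have h : ∀ v : E, ‖Complex.I • v‖ = ‖v‖ := fun v => by simp [norm_smul]
  rw [real_inner_eq_norm_add_mul_self_sub_norm_mul_self_sub_norm_mul_self_div_two,
    real_inner_eq_norm_add_mul_self_sub_norm_mul_self_sub_norm_mul_self_div_two,
    ← smul_add, h, h, h]

variable [IsScalarTower ℝ ℂ E]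

theorem complex_smul_eq_re_add_im (z : ℂ) (v : E) :
    z • v = z.re • v + z.im • (Complex.I • v) := by
  conv_lhs => rw [← Complex.re_add_im z]
  rw [add_smul, mul_smul]
  congr 1
  · rw [← algebraMap_smul ℂ z.re v]; rfl
  · rw [← algebraMap_smul ℂ z.im (Complex.I • v)]; rfl

/-- The two terms on the right separate the conditions used later: one vanishes because the position
is orthogonal to tangent vectors, the other because the map is `𝒞`-totally real. -/
theorem inner_complex_smul_smul (z w : ℂ) (v v' : E) :
    inner ℝ (z • v) (w • v') = (z.re * w.re + z.im * w.im) * inner ℝ v v' +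
      (z.im * w.re - z.re * w.im) * inner ℝ (Complex.I • v) v' := by
  have h : inner ℝ v (Complex.I • v') = - inner ℝ (Complex.I • v) v' := by
    rw [← inner_I_smul_I_smul v (Complex.I • v'), smul_smul, Complex.I_mul_I, neg_one_smul,
      inner_neg_right]
  rw [complex_smul_eq_re_add_im z, complex_smul_eq_re_add_im w]
  simp only [inner_add_left, inner_add_right, real_inner_smul_left, real_inner_smul_right, h,
    inner_I_smul_I_smul]
  ring

theorem inner_complex_smul_smul_self (z : ℂ) (v v' : E) :
    inner ℝ (z • v) (z • v') = ‖z‖ ^ 2 * inner ℝ v v' := by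
  rw [inner_complex_smul_smul, Complex.sq_norm, Complex.normSq_apply]
  ring

/-- With `d` the squared speed and `r = |z|²`, the acceleration term cancels the radial term `-k f`
of the minimal factor. What remains has the same coefficient `-c` in both factors, so the two parts
assemble to a multiple of the position vector of the product. -/
theorem smul_add_smul_eq_of_balance (z : ℂ) (f w : E) {d r : ℝ} (hd : d ≠ 0) (k c : ℝ) :
    d⁻¹ • ((d * (k / r - c)) • z) • f + z • r⁻¹ • (w - k • f) =
      z • r⁻¹ • w + (-c) • z • f := by
  have h : (d * (k / r - c)) = d * (k * r⁻¹ - c) := by rw [div_eq_mul_inv]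
  rw [h, smul_sub, smul_sub, smul_comm z r⁻¹ (k • f), smul_comm z k f, smul_assoc, smul_smul,
    ← mul_assoc, inv_mul_cancel₀ hd]
  module

end ComplexStructure

/-! ### First and second derivatives of the product, and its minimality. -/

section Product

variable {V₁ : Type*} [NormedAddCommGroup V₁] [NormedSpace ℝ V₁]
variable {V₂ : Type*} [NormedAddCommGroup V₂] [NormedSpace ℝ V₂]
variable {E₁ : Type*} [NormedAddCommGroup E₁] [InnerProductSpace ℝ E₁]
variable {E₂ : Type*} [NormedAddCommGroup E₂] [InnerProductSpace ℝ E₂]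

theorem hasDerivAt_toLp_prodMk {g₁ : ℝ → E₁} {g₂ : ℝ → E₂} {g₁' : E₁} {g₂' : E₂} {s : ℝ}
    (h₁ : HasDerivAt g₁ g₁' s) (h₂ : HasDerivAt g₂ g₂' s) :
    HasDerivAt (fun s => (WithLp.toLp 2 (g₁ s, g₂ s) : WithLp 2 (E₁ × E₂)))
      (WithLp.toLp 2 (g₁', g₂')) s :=
  ((WithLp.prodContinuousLinearEquiv 2 ℝ E₁ E₂).symm.hasFDerivAt).comp_hasDerivAt s
    (h₁.prodMk h₂)

variable [NormedSpace ℂ E₁] [NormedSpace ℂ E₂]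

/-- The product `(t, x, y) ↦ (z₁(t) F₁(x), z₂(t) F₂(y))` of two maps along a curve in `ℂ²`. -/
def smulProduct (z₁ z₂ : ℝ → ℂ) (F₁ : V₁ → E₁) (F₂ : V₂ → E₂) (q : ℝ × V₁ × V₂) :
    WithLp 2 (E₁ × E₂) :=
  WithLp.toLp 2 (z₁ q.1 • F₁ q.2.1, z₂ q.1 • F₂ q.2.2)

variable [IsScalarTower ℝ ℂ E₁] [IsScalarTower ℝ ℂ E₂]
variable {z₁ z₂ : ℝ → ℂ} {F₁ : V₁ → E₁} {F₂ : V₂ → E₂} {t : ℝ} {u : V₁} {v : V₂}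

theorem contDiffAt_smulProduct {n : ℕ∞ω} (hz₁ : ContDiffAt ℝ n z₁ t) (hz₂ : ContDiffAt ℝ n z₂ t)
    (hF₁ : ContDiffAt ℝ n F₁ u) (hF₂ : ContDiffAt ℝ n F₂ v) :
    ContDiffAt ℝ n (smulProduct z₁ z₂ F₁ F₂) (t, u, v) := by
  have h1 : ContDiffAt ℝ n (fun q : ℝ × V₁ × V₂ => z₁ q.1 • F₁ q.2.1) (t, u, v) :=
    (hz₁.comp (t, u, v) contDiffAt_fst).smul
      (hF₁.comp (t, u, v) (contDiffAt_fst.comp (t, u, v) contDiffAt_snd))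
  have h2 : ContDiffAt ℝ n (fun q : ℝ × V₁ × V₂ => z₂ q.1 • F₂ q.2.2) (t, u, v) :=
    (hz₂.comp (t, u, v) contDiffAt_fst).smul
      (hF₂.comp (t, u, v) (contDiffAt_snd.comp (t, u, v) contDiffAt_snd))
  exact ((WithLp.prodContinuousLinearEquiv 2 ℝ E₁ E₂).symm.contDiff.contDiffAt).comp (t, u, v)
    (h1.prodMk h2)

theorem fderiv_smulProduct (hz₁ : DifferentiableAt ℝ z₁ t) (hz₂ : DifferentiableAt ℝ z₂ t)
    (hF₁ : DifferentiableAt ℝ F₁ u) (hF₂ : DifferentiableAt ℝ F₂ v) (τ : ℝ) (ξ : V₁) (η : V₂) :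
    fderiv ℝ (smulProduct z₁ z₂ F₁ F₂) (t, u, v) (τ, ξ, η) =
      WithLp.toLp 2 ((τ • deriv z₁ t) • F₁ u + z₁ t • fderiv ℝ F₁ u ξ,
        (τ • deriv z₂ t) • F₂ v + z₂ t • fderiv ℝ F₂ v η) := by
  have h1 : HasFDerivAt (fun q : ℝ × V₁ × V₂ => z₁ q.1 • F₁ q.2.1) _ (t, u, v) :=
    (hz₁.hasFDerivAt.comp (t, u, v) hasFDerivAt_fst).smul
      (hF₁.hasFDerivAt.comp (t, u, v) (hasFDerivAt_fst.comp (t, u, v) hasFDerivAt_snd))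
  have h2 : HasFDerivAt (fun q : ℝ × V₁ × V₂ => z₂ q.1 • F₂ q.2.2) _ (t, u, v) :=
    (hz₂.hasFDerivAt.comp (t, u, v) hasFDerivAt_fst).smul
      (hF₂.hasFDerivAt.comp (t, u, v) (hasFDerivAt_snd.comp (t, u, v) hasFDerivAt_snd))
  have h3 : HasFDerivAt (smulProduct z₁ z₂ F₁ F₂) _ (t, u, v) :=
    ((WithLp.prodContinuousLinearEquiv 2 ℝ E₁ E₂).symm.hasFDerivAt).comp (t, u, v)
    (h1.prodMk h2)
  rw [h3.fderiv]
  have e1 : fderiv ℝ z₁ t τ = τ • deriv z₁ t := fderiv_eq_smul_deriv _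
  have e2 : fderiv ℝ z₂ t τ = τ • deriv z₂ t := fderiv_eq_smul_deriv _
  rw [← e1, ← e2]
  simp [add_comm]

/-- Pairs of tangent vectors of a product of `𝒞`-totally real maps. -/
theorem inner_fderiv_smulProduct (hz₁ : DifferentiableAt ℝ z₁ t) (hz₂ : DifferentiableAt ℝ z₂ t)
    (hF₁ : DifferentiableAt ℝ F₁ u) (hF₂ : DifferentiableAt ℝ F₂ v)
    (hn₁ : ∀ y, ‖F₁ y‖ = 1) (hn₂ : ∀ y, ‖F₂ y‖ = 1)
    (hr₁ : ∀ ξ, inner ℝ (Complex.I • F₁ u) (fderiv ℝ F₁ u ξ) = 0)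
    (hr₂ : ∀ η, inner ℝ (Complex.I • F₂ v) (fderiv ℝ F₂ v η) = 0)
    (τ τ' : ℝ) (ξ ξ' : V₁) (η η' : V₂) :
    inner ℝ (fderiv ℝ (smulProduct z₁ z₂ F₁ F₂) (t, u, v) (τ, ξ, η))
      (fderiv ℝ (smulProduct z₁ z₂ F₁ F₂) (t, u, v) (τ', ξ', η')) =
      τ * τ' * (‖deriv z₁ t‖ ^ 2 + ‖deriv z₂ t‖ ^ 2) +
        ‖z₁ t‖ ^ 2 * inner ℝ (fderiv ℝ F₁ u ξ) (fderiv ℝ F₁ u ξ') +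
        ‖z₂ t‖ ^ 2 * inner ℝ (fderiv ℝ F₂ v η) (fderiv ℝ F₂ v η') := by
  rw [fderiv_smulProduct hz₁ hz₂ hF₁ hF₂, fderiv_smulProduct hz₁ hz₂ hF₁ hF₂]
  -- The curve direction is orthogonal to the directions of the factor: this is where `𝒞`-total
  -- reality enters.
  have o1 : ∀ (z w : ℂ) ξ, inner ℝ (z • F₁ u) (w • fderiv ℝ F₁ u ξ) = 0 := fun z w ξ => by
    rw [inner_complex_smul_smul, hr₁, inner_fderiv_eq_zero_of_norm_eq_one hn₁ hF₁]; simp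
  have o2 : ∀ (z w : ℂ) η, inner ℝ (z • F₂ v) (w • fderiv ℝ F₂ v η) = 0 := fun z w η => by
    rw [inner_complex_smul_smul, hr₂, inner_fderiv_eq_zero_of_norm_eq_one hn₂ hF₂]; simp
  have o1' : ∀ (z w : ℂ) ξ, inner ℝ (w • fderiv ℝ F₁ u ξ) (z • F₁ u) = 0 := fun z w ξ => by
    rw [real_inner_comm, o1]
  have o2' : ∀ (z w : ℂ) η, inner ℝ (w • fderiv ℝ F₂ v η) (z • F₂ v) = 0 := fun z w η => by
    rw [real_inner_comm, o2]
  simp only [WithLp.prod_inner_apply, inner_add_left, inner_add_right, o1, o2, o1', o2',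
    inner_complex_smul_smul_self, smul_assoc, real_inner_smul_left, real_inner_smul_right,
    real_inner_self_eq_norm_sq, norm_smul, hn₁, hn₂, mul_one]
  ring

theorem fderiv_smulProduct_injective (hz₁ : DifferentiableAt ℝ z₁ t)
    (hz₂ : DifferentiableAt ℝ z₂ t)
    (hF₁ : DifferentiableAt ℝ F₁ u) (hF₂ : DifferentiableAt ℝ F₂ v)
    (hn₁ : ∀ y, ‖F₁ y‖ = 1) (hn₂ : ∀ y, ‖F₂ y‖ = 1)
    (hr₁ : ∀ ξ, inner ℝ (Complex.I • F₁ u) (fderiv ℝ F₁ u ξ) = 0)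
    (hr₂ : ∀ η, inner ℝ (Complex.I • F₂ v) (fderiv ℝ F₂ v η) = 0)
    (hi₁ : Function.Injective (fderiv ℝ F₁ u)) (hi₂ : Function.Injective (fderiv ℝ F₂ v))
    (hd : 0 < ‖deriv z₁ t‖ ^ 2 + ‖deriv z₂ t‖ ^ 2) (h₁ : z₁ t ≠ 0) (h₂ : z₂ t ≠ 0) :
    Function.Injective (fderiv ℝ (smulProduct z₁ z₂ F₁ F₂) (t, u, v)) := by
  rw [injective_iff_map_eq_zero]
  rintro ⟨τ, ξ, η⟩ h0
  have h := inner_fderiv_smulProduct hz₁ hz₂ hF₁ hF₂ hn₁ hn₂ hr₁ hr₂ τ τ ξ ξ η η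
  rw [h0, inner_zero_left, real_inner_self_eq_norm_sq, real_inner_self_eq_norm_sq] at h
  have p1 : 0 < ‖z₁ t‖ ^ 2 := by positivity
  have p2 : 0 < ‖z₂ t‖ ^ 2 := by positivity
  have a1 : 0 ≤ τ * τ * (‖deriv z₁ t‖ ^ 2 + ‖deriv z₂ t‖ ^ 2) :=
    mul_nonneg (mul_self_nonneg τ) hd.le
  have a2 : 0 ≤ ‖z₁ t‖ ^ 2 * ‖fderiv ℝ F₁ u ξ‖ ^ 2 := by positivity
  have a3 : 0 ≤ ‖z₂ t‖ ^ 2 * ‖fderiv ℝ F₂ v η‖ ^ 2 := by positivity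
  have b1 : τ * τ * (‖deriv z₁ t‖ ^ 2 + ‖deriv z₂ t‖ ^ 2) = 0 := by linarith
  have b2 : ‖z₁ t‖ ^ 2 * ‖fderiv ℝ F₁ u ξ‖ ^ 2 = 0 := by linarith
  have b3 : ‖z₂ t‖ ^ 2 * ‖fderiv ℝ F₂ v η‖ ^ 2 = 0 := by linarith
  simp only [mul_eq_zero, hd.ne', p1.ne', p2.ne', or_false, false_or, or_self,
    pow_eq_zero_iff two_ne_zero, norm_eq_zero] at b1 b2 b3
  rw [b1, (injective_iff_map_eq_zero _).1 hi₁ ξ b2, (injective_iff_map_eq_zero _).1 hi₂ η b3]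
  rfl

theorem smulProduct_fderiv_fderiv_fst (hz₁ : ContDiff ℝ 2 z₁) (hz₂ : ContDiff ℝ 2 z₂)
    (hF₁ : ContDiffAt ℝ 2 F₁ u) (hF₂ : ContDiffAt ℝ 2 F₂ v) (τ : ℝ) :
    fderiv ℝ (fderiv ℝ (smulProduct z₁ z₂ F₁ F₂)) (t, u, v) (τ, 0, 0) (τ, 0, 0) =
      (τ * τ) • WithLp.toLp 2 (deriv (deriv z₁) t • F₁ u, deriv (deriv z₂) t • F₂ v) := by
  have key : ∀ {z : ℝ → ℂ}, ContDiff ℝ 2 z → ∀ s,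
      HasDerivAt (fun s : ℝ => z (t + s * τ)) (τ • deriv z (t + s * τ)) s ∧
      HasDerivAt (fun s : ℝ => τ • deriv z (t + s * τ)) ((τ * τ) • deriv (deriv z) (t + s * τ)) s := by
    intro z hz s
    have h2 : HasDerivAt (fun s : ℝ => t + s * τ) τ s := by
      simpa using ((hasDerivAt_id s).mul_const τ).const_add t
    have hd : ContDiff ℝ 1 (deriv z) := ((contDiff_succ_iff_deriv (n := 1)).1 hz).2.2
    refine ⟨(hz.differentiable (by norm_num) _).hasDerivAt.scomp s h2, ?_⟩
    rw [mul_smul]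
    exact ((hd.differentiable (by norm_num) _).hasDerivAt.scomp s h2).const_smul τ
  have h := fderiv_fderiv_eq_of_line
    (contDiffAt_smulProduct (hz₁.contDiffAt (x := t)) hz₂.contDiffAt hF₁ hF₂) (τ, 0, 0)
    (g' := fun s => WithLp.toLp 2 ((τ • deriv z₁ (t + s * τ)) • F₁ u,
      (τ • deriv z₂ (t + s * τ)) • F₂ v))
    (g'' := WithLp.toLp 2 (((τ * τ) • deriv (deriv z₁) (t + 0 * τ)) • F₁ u,
      ((τ * τ) • deriv (deriv z₂) (t + 0 * τ)) • F₂ v))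
    (Filter.Eventually.of_forall fun s => by
      have := hasDerivAt_toLp_prodMk (((key hz₁ s).1).smul_const (F₁ u))
        (((key hz₂ s).1).smul_const (F₂ v))
      simpa [smulProduct] using this)
    (hasDerivAt_toLp_prodMk (((key hz₁ 0).2).smul_const (F₁ u))
        (((key hz₂ 0).2).smul_const (F₂ v)))
  rw [h]
  simp only [zero_mul, add_zero, smul_assoc]
  rfl

theorem smulProduct_fderiv_fderiv_snd_fst (hz₁ : ContDiffAt ℝ 2 z₁ t) (hz₂ : ContDiffAt ℝ 2 z₂ t)
    (hF₁ : ContDiffAt ℝ 2 F₁ u) (hF₂ : ContDiffAt ℝ 2 F₂ v) (ξ : V₁) :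
    fderiv ℝ (fderiv ℝ (smulProduct z₁ z₂ F₁ F₂)) (t, u, v) (0, ξ, 0) (0, ξ, 0) =
      WithLp.toLp 2 (z₁ t • fderiv ℝ (fderiv ℝ F₁) u ξ ξ, 0) := by
  refine fderiv_fderiv_eq_of_line (contDiffAt_smulProduct hz₁ hz₂ hF₁ hF₂) (0, ξ, 0)
    (g' := fun s => WithLp.toLp 2 (z₁ t • fderiv ℝ F₁ (u + s • ξ) ξ, 0)) ?_
    (hasDerivAt_toLp_prodMk ((hasDerivAt_fderiv_line hF₁ ξ).const_smul (z₁ t))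
      (hasDerivAt_const _ _))
  filter_upwards [eventually_hasDerivAt_line hF₁ ξ] with s hs
  have := hasDerivAt_toLp_prodMk (hs.const_smul (z₁ t)) (hasDerivAt_const s (z₂ t • F₂ v))
  simpa [smulProduct] using this

theorem smulProduct_fderiv_fderiv_snd_snd (hz₁ : ContDiffAt ℝ 2 z₁ t) (hz₂ : ContDiffAt ℝ 2 z₂ t)
    (hF₁ : ContDiffAt ℝ 2 F₁ u) (hF₂ : ContDiffAt ℝ 2 F₂ v) (η : V₂) :
    fderiv ℝ (fderiv ℝ (smulProduct z₁ z₂ F₁ F₂)) (t, u, v) (0, 0, η) (0, 0, η) =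
      WithLp.toLp 2 (0, z₂ t • fderiv ℝ (fderiv ℝ F₂) v η η) := by
  refine fderiv_fderiv_eq_of_line (contDiffAt_smulProduct hz₁ hz₂ hF₁ hF₂) (0, 0, η)
    (g' := fun s => WithLp.toLp 2 (0, z₂ t • fderiv ℝ F₂ (v + s • η) η)) ?_
    (hasDerivAt_toLp_prodMk (hasDerivAt_const _ _)
      ((hasDerivAt_fderiv_line hF₂ η).const_smul (z₂ t)))
  filter_upwards [eventually_hasDerivAt_line hF₂ η] with s hs
  have := hasDerivAt_toLp_prodMk (hasDerivAt_const s (z₁ t • F₁ u)) (hs.const_smul (z₂ t))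
  simpa [smulProduct] using this

variable [FiniteDimensional ℝ V₁] [FiniteDimensional ℝ V₂]
variable [FiniteDimensional ℝ E₁] [FiniteDimensional ℝ E₂]

/-- A product of `𝒞`-totally real minimal parametrizations along a curve which satisfies the
geodesic equation of the weighted metric `|z₁|^(2k₁) |z₂|^(2k₂) |dz|²` is minimal. -/
theorem meanCurvatureVector_smulProduct (hz₁ : ContDiff ℝ 2 z₁) (hz₂ : ContDiff ℝ 2 z₂)
    (hF₁ : ContDiffAt ℝ 2 F₁ u) (hF₂ : ContDiffAt ℝ 2 F₂ v)
    (hn₁ : ∀ y, ‖F₁ y‖ = 1) (hn₂ : ∀ y, ‖F₂ y‖ = 1)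
    (hr₁ : ∀ ξ, inner ℝ (Complex.I • F₁ u) (fderiv ℝ F₁ u ξ) = 0)
    (hr₂ : ∀ η, inner ℝ (Complex.I • F₂ v) (fderiv ℝ F₂ v η) = 0)
    (hi₁ : Function.Injective (fderiv ℝ F₁ u)) (hi₂ : Function.Injective (fderiv ℝ F₂ v))
    (hm₁ : meanCurvatureVector F₁ u = 0) (hm₂ : meanCurvatureVector F₂ v = 0)
    (hd : 0 < ‖deriv z₁ t‖ ^ 2 + ‖deriv z₂ t‖ ^ 2) (h₁ : z₁ t ≠ 0) (h₂ : z₂ t ≠ 0) (c : ℝ)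
    (heq₁ : deriv (deriv z₁) t = ((‖deriv z₁ t‖ ^ 2 + ‖deriv z₂ t‖ ^ 2) *
      (Module.finrank ℝ V₁ / ‖z₁ t‖ ^ 2 - c)) • z₁ t)
    (heq₂ : deriv (deriv z₂) t = ((‖deriv z₁ t‖ ^ 2 + ‖deriv z₂ t‖ ^ 2) *
      (Module.finrank ℝ V₂ / ‖z₂ t‖ ^ 2 - c)) • z₂ t) :
    meanCurvatureVector (smulProduct z₁ z₂ F₁ F₂) (t, u, v) = 0 := by
  have dz₁ := hz₁.differentiable (by norm_num) t
  have dz₂ := hz₂.differentiable (by norm_num) t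
  have dF₁ := hF₁.differentiableAt (by norm_num)
  have dF₂ := hF₂.differentiableAt (by norm_num)
  obtain ⟨e₁, he₁⟩ := exists_orthonormal_fderiv F₁ u hi₁
  obtain ⟨e₂, he₂⟩ := exists_orthonormal_fderiv F₂ v hi₂
  obtain ⟨w₁, hw₁⟩ := exists_sum_fderiv_fderiv_eq hn₁ hF₁ hm₁ e₁ he₁
  obtain ⟨w₂, hw₂⟩ := exists_sum_fderiv_fderiv_eq hn₂ hF₂ hm₂ e₂ he₂
  set d := ‖deriv z₁ t‖ ^ 2 + ‖deriv z₂ t‖ ^ 2 with hd_def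
  have p1 : 0 < ‖z₁ t‖ := norm_pos_iff.2 h₁
  have p2 : 0 < ‖z₂ t‖ := norm_pos_iff.2 h₂
  have hsd : √d * √d = d := Real.mul_self_sqrt hd.le
  -- The induced metric is an orthogonal sum of the squared speed and the factor metrics scaled by
  -- `|z₁|²` and `|z₂|²`, so rescaled frames of the factors give an orthonormal frame.
  let e : Unit ⊕ (Fin (Module.finrank ℝ V₁) ⊕ Fin (Module.finrank ℝ V₂)) → ℝ × V₁ × V₂ :=
    Sum.elim (fun _ => ((√d)⁻¹, 0, 0))
      (Sum.elim (fun a => (0, ‖z₁ t‖⁻¹ • e₁ a, 0)) (fun a => (0, 0, ‖z₂ t‖⁻¹ • e₂ a)))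
  have hcard : Fintype.card (Unit ⊕ (Fin (Module.finrank ℝ V₁) ⊕ Fin (Module.finrank ℝ V₂))) =
      Module.finrank ℝ (ℝ × V₁ × V₂) := by
    simp [Module.finrank_prod]
  have hsq : (√d)⁻¹ * (√d)⁻¹ = d⁻¹ := by rw [← mul_inv, hsd]
  rw [meanCurvatureVector_eq_starProjection _ _ hcard e]
  -- The trace is a tangent vector plus a multiple of the position vector, and the normal projection
  -- kills both.
  · have hsum : ∑ a, fderiv ℝ (fderiv ℝ (smulProduct z₁ z₂ F₁ F₂)) (t, u, v) (e a) (e a) =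
        fderiv ℝ (smulProduct z₁ z₂ F₁ F₂) (t, u, v)
          (0, (‖z₁ t‖ ^ 2)⁻¹ • w₁, (‖z₂ t‖ ^ 2)⁻¹ • w₂) +
        (-c) • smulProduct z₁ z₂ F₁ F₂ (t, u, v) := by
      have s1 : ∀ a, fderiv ℝ (fderiv ℝ F₁) u (‖z₁ t‖⁻¹ • e₁ a) (‖z₁ t‖⁻¹ • e₁ a) =
          (‖z₁ t‖ ^ 2)⁻¹ • fderiv ℝ (fderiv ℝ F₁) u (e₁ a) (e₁ a) := fun a => by
        simp only [map_smul, _root_.smul_apply, smul_smul]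
        congr 1; rw [← mul_inv, sq]
      have s2 : ∀ a, fderiv ℝ (fderiv ℝ F₂) v (‖z₂ t‖⁻¹ • e₂ a) (‖z₂ t‖⁻¹ • e₂ a) =
          (‖z₂ t‖ ^ 2)⁻¹ • fderiv ℝ (fderiv ℝ F₂) v (e₂ a) (e₂ a) := fun a => by
        simp only [map_smul, _root_.smul_apply, smul_smul]
        congr 1; rw [← mul_inv, sq]
      simp only [Fintype.sum_sum_type, e, Sum.elim_inl, Sum.elim_inr, Finset.univ_unique,
        Finset.sum_singleton, smulProduct_fderiv_fderiv_fst hz₁ hz₂ hF₁ hF₂,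
        smulProduct_fderiv_fderiv_snd_fst hz₁.contDiffAt hz₂.contDiffAt hF₁ hF₂,
        smulProduct_fderiv_fderiv_snd_snd hz₁.contDiffAt hz₂.contDiffAt hF₁ hF₂,
        fderiv_smulProduct dz₁ dz₂ dF₁ dF₂, s1, s2, hsq]
      refine WithLp.ofLp_injective 2 (Prod.ext ?_ ?_)
      · simp only [WithLp.ofLp_add, WithLp.ofLp_smul, WithLp.ofLp_sum, Prod.fst_add, Prod.smul_fst,
          Prod.fst_sum, smulProduct, Finset.sum_const_zero, add_zero, zero_smul, zero_add, map_smul,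
          ← Finset.smul_sum, hw₁, heq₁]
        exact smul_add_smul_eq_of_balance (z₁ t) _ _ hd.ne' _ c
      · simp only [WithLp.ofLp_add, WithLp.ofLp_smul, WithLp.ofLp_sum, Prod.snd_add, Prod.smul_snd,
          Prod.snd_sum, smulProduct, Finset.sum_const_zero, zero_smul, zero_add, map_smul,
          ← Finset.smul_sum, hw₂, heq₂]
        exact smul_add_smul_eq_of_balance (z₂ t) _ _ hd.ne' _ c
    rw [hsum, Submodule.starProjection_apply_eq_zero_iff, sphereNormalSpace,
      Submodule.orthogonal_orthogonal]
    exact Submodule.add_mem_sup ⟨_, rfl⟩ (Submodule.smul_mem _ _ (Submodule.mem_span_singleton_self _))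
  · have hh := inner_fderiv_smulProduct dz₁ dz₂ dF₁ dF₂ hn₁ hn₂ hr₁ hr₂
    rintro (a | a | a) (b | b | b) <;>
      simp only [e, Sum.elim_inl, Sum.elim_inr, hh, map_zero, map_smul, inner_zero_left,
        inner_zero_right, real_inner_smul_left, real_inner_smul_right, he₁, he₂, mul_zero, zero_mul,
        add_zero, zero_add, reduceCtorEq, if_false, Sum.inl.injEq, Sum.inr.injEq]
    · rw [hsq, if_pos trivial, ← hd_def]; exact inv_mul_cancel₀ hd.ne'
    · field_simp
    · field_simp

end Product

/-! ### Derivatives and smoothness read in the chart at a point. -/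

section Chart

variable {V : Type*} [NormedAddCommGroup V] [NormedSpace ℝ V]
variable {H : Type*} [TopologicalSpace H] {M : Type*} [TopologicalSpace M] [ChartedSpace H M]
variable {I : ModelWithCorners ℝ V H} [I.Boundaryless]
variable {E : Type*} [NormedAddCommGroup E] [NormedSpace ℝ E]

theorem mfderiv_eq_fderiv_extChartAt {f : M → E} {p : M} (hf : MDifferentiableAt I 𝓘(ℝ, E) f p) :
    mfderiv I 𝓘(ℝ, E) f p = fderiv ℝ (f ∘ (extChartAt I p).symm) (extChartAt I p p) := by
  rw [hf.mfderiv, I.range_eq_univ, fderivWithin_univ]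
  rfl

theorem contMDiffAt_iff_contDiffAt_extChartAt {n : ℕ∞ω} {f : M → E} {p : M} :
    ContMDiffAt I 𝓘(ℝ, E) n f p ↔ ContinuousAt f p ∧
      ContDiffAt ℝ n (f ∘ (extChartAt I p).symm) (extChartAt I p p) := by
  rw [contMDiffAt_iff, I.range_eq_univ, contDiffWithinAt_univ]
  rfl

end Chart

/-! ### From parametrizations to the product of manifolds. -/

section GammaProduct

variable {k₁ k₂ m₁ m₂ : ℕ}
variable {M₁ : Type*} [TopologicalSpace M₁] [ChartedSpace (EuclideanSpace ℝ (Fin k₁)) M₁]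
variable {M₂ : Type*} [TopologicalSpace M₂] [ChartedSpace (EuclideanSpace ℝ (Fin k₂)) M₂]
variable {f₁ : M₁ → EuclideanSpace ℂ (Fin (m₁ + 1))} {f₂ : M₂ → EuclideanSpace ℂ (Fin (m₂ + 1))}

theorem gammaProduct_comp_extChartAt_symm (γ : ℝ → ℂ × ℂ) (q : ℝ × M₁ × M₂) :
    gammaProduct γ f₁ f₂ ∘ (extChartAt (𝓘(ℝ, ℝ).prod ((𝓡 k₁).prod (𝓡 k₂))) q).symm =
      smulProduct (fun t => (γ t).1) (fun t => (γ t).2)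
        (f₁ ∘ (extChartAt (𝓡 k₁) q.2.1).symm) (f₂ ∘ (extChartAt (𝓡 k₂) q.2.2).symm) := by
  funext x
  simp only [extChartAt_prod, extChartAt_model_space_eq_id]
  simp [gammaProduct, smulProduct]

theorem extChartAt_triple_self (q : ℝ × M₁ × M₂) :
    extChartAt (𝓘(ℝ, ℝ).prod ((𝓡 k₁).prod (𝓡 k₂))) q q =
      (q.1, extChartAt (𝓡 k₁) q.2.1 q.2.1, extChartAt (𝓡 k₂) q.2.2 q.2.2) := by
  simp only [extChartAt_prod, extChartAt_model_space_eq_id]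
  simp

/-- The product along a curve in `S³` which satisfies the geodesic equation of the weighted metric
`|γ₁|^(2k₁) |γ₂|^(2k₂) |dγ|²` is a minimal immersion. -/
theorem isMinimalSphericalImmersion_gammaProduct
    (hf₁ : IsMinimalSphericalImmersion (𝓡 k₁) f₁) (hf₂ : IsMinimalSphericalImmersion (𝓡 k₂) f₂)
    (hr₁ : IsCTotallyReal (𝓡 k₁) f₁) (hr₂ : IsCTotallyReal (𝓡 k₂) f₂)
    {z₁ z₂ : ℝ → ℂ} (hz₁ : ContDiff ℝ ∞ z₁) (hz₂ : ContDiff ℝ ∞ z₂)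
    (hsphere : ∀ t, ‖z₁ t‖ ^ 2 + ‖z₂ t‖ ^ 2 = 1)
    (hd : ∀ t, 0 < ‖deriv z₁ t‖ ^ 2 + ‖deriv z₂ t‖ ^ 2)
    (h₁ : ∀ t, z₁ t ≠ 0) (h₂ : ∀ t, z₂ t ≠ 0) (c : ℝ)
    (heq₁ : ∀ t, deriv (deriv z₁) t = ((‖deriv z₁ t‖ ^ 2 + ‖deriv z₂ t‖ ^ 2) *
      (k₁ / ‖z₁ t‖ ^ 2 - c)) • z₁ t)
    (heq₂ : ∀ t, deriv (deriv z₂) t = ((‖deriv z₁ t‖ ^ 2 + ‖deriv z₂ t‖ ^ 2) *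
      (k₂ / ‖z₂ t‖ ^ 2 - c)) • z₂ t) :
    IsMinimalSphericalImmersion (𝓘(ℝ, ℝ).prod ((𝓡 k₁).prod (𝓡 k₂)))
      (gammaProduct (fun t => (z₁ t, z₂ t)) f₁ f₂) := by
  have c₁ := fun x => contMDiffAt_iff_contDiffAt_extChartAt.1 (hf₁.contMDiff x)
  have c₂ := fun y => contMDiffAt_iff_contDiffAt_extChartAt.1 (hf₂.contMDiff y)
  have n₁ : ∀ x y, ‖(f₁ ∘ (extChartAt (𝓡 k₁) x).symm) y‖ = 1 := fun x y => hf₁.norm_eq_one _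
  have n₂ : ∀ x y, ‖(f₂ ∘ (extChartAt (𝓡 k₂) x).symm) y‖ = 1 := fun x y => hf₂.norm_eq_one _
  have e₁ := fun x => mfderiv_eq_fderiv_extChartAt ((hf₁.contMDiff x).mdifferentiableAt (by simp))
  have e₂ := fun x => mfderiv_eq_fderiv_extChartAt ((hf₂.contMDiff x).mdifferentiableAt (by simp))
  have i₁ := hf₁.mfderiv_injective
  have i₂ := hf₂.mfderiv_injective
  have r₁ : ∀ x ξ, inner ℝ (Complex.I • (f₁ ∘ (extChartAt (𝓡 k₁) x).symm) (extChartAt (𝓡 k₁) x x))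
      (fderiv ℝ (f₁ ∘ (extChartAt (𝓡 k₁) x).symm) (extChartAt (𝓡 k₁) x x) ξ) = 0 := by
    intro x ξ
    have := hr₁ x ξ
    rw [e₁] at this
    rw [Function.comp_apply, extChartAt_to_inv]
    exact this
  have r₂ : ∀ x ξ, inner ℝ (Complex.I • (f₂ ∘ (extChartAt (𝓡 k₂) x).symm) (extChartAt (𝓡 k₂) x x))
      (fderiv ℝ (f₂ ∘ (extChartAt (𝓡 k₂) x).symm) (extChartAt (𝓡 k₂) x x) ξ) = 0 := by
    intro x ξ
    have := hr₂ x ξ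
    rw [e₂] at this
    rw [Function.comp_apply, extChartAt_to_inv]
    exact this
  have d₁ := fun x => ((c₁ x).2.differentiableAt (by simp))
  have d₂ := fun x => ((c₂ x).2.differentiableAt (by simp))
  have hsm : ContMDiff (𝓘(ℝ, ℝ).prod ((𝓡 k₁).prod (𝓡 k₂))) 
      𝓘(ℝ, WithLp 2 (EuclideanSpace ℂ (Fin (m₁ + 1)) × EuclideanSpace ℂ (Fin (m₂ + 1)))) ∞
      (gammaProduct (fun t => (z₁ t, z₂ t)) f₁ f₂) := by
    rintro ⟨t, x, y⟩
    rw [contMDiffAt_iff_contDiffAt_extChartAt, gammaProduct_comp_extChartAt_symm,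
      extChartAt_triple_self]
    refine ⟨?_, contDiffAt_smulProduct hz₁.contDiffAt hz₂.contDiffAt (c₁ x).2 (c₂ y).2⟩
    have := hf₁.contMDiff.continuous
    have := hf₂.contMDiff.continuous
    have := hz₁.continuous
    have := hz₂.continuous
    unfold gammaProduct
    fun_prop
  refine ⟨fun q => ?_, hsm, ?_, ?_⟩
  · rw [← sq_eq_sq₀ (norm_nonneg _) zero_le_one, WithLp.prod_norm_sq_eq_of_L2]
    simp [gammaProduct, norm_smul, hf₁.norm_eq_one, hf₂.norm_eq_one, hsphere]
  · rintro ⟨t, x, y⟩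
    rw [mfderiv_eq_fderiv_extChartAt ((hsm _).mdifferentiableAt (by simp)),
      gammaProduct_comp_extChartAt_symm, extChartAt_triple_self]
    have i₁ := i₁ x
    have i₂ := i₂ y
    rw [e₁] at i₁
    rw [e₂] at i₂
    exact fderiv_smulProduct_injective (hz₁.differentiable (by simp) t)
      (hz₂.differentiable (by simp) t) (d₁ x) (d₂ y) (n₁ x) (n₂ y) (r₁ x) (r₂ y) i₁ i₂ (hd t) (h₁ t)
      (h₂ t)
  · rintro ⟨t, x, y⟩
    have i₁ := i₁ x
    have i₂ := i₂ y
    rw [e₁] at i₁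
    rw [e₂] at i₂
    rw [gammaProduct_comp_extChartAt_symm, extChartAt_triple_self]
    have h2 : ((2 : ℕ∞) : ℕ∞ω) ≤ ((⊤ : ℕ∞) : ℕ∞ω) := WithTop.coe_le_coe.2 le_top
    exact meanCurvatureVector_smulProduct (hz₁.of_le h2) (hz₂.of_le h2) ((c₁ x).2.of_le h2)
      ((c₂ y).2.of_le h2) (n₁ x) (n₂ y) (r₁ x) (r₂ y) i₁ i₂ (hf₁.meanCurvature_eq_zero x)
      (hf₂.meanCurvature_eq_zero y) (hd t) (h₁ t) (h₂ t) c (by simpa using heq₁ t)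
      (by simpa using heq₂ t)

end GammaProduct

/-! ### Plane curves rebuilt from squared magnitude and angular momentum. -/

section PolarCurve

/-- The curve in `ℂ` with squared magnitude `s`, angular momentum `J` and initial argument `0`. -/
def polarCurve (s : ℝ → ℝ) (J : ℝ) (t : ℝ) : ℂ :=
  (√(s t) : ℝ) * Complex.exp ((∫ τ in (0 : ℝ)..t, J / s τ : ℝ) * Complex.I)

variable {s : ℝ → ℝ} {J : ℝ}

theorem norm_polarCurve (t : ℝ) : ‖polarCurve s J t‖ = √(s t) := by
  rw [polarCurve, norm_mul, Complex.norm_exp_ofReal_mul_I, mul_one, Complex.norm_real,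
    Real.norm_of_nonneg (Real.sqrt_nonneg _)]

theorem norm_sq_polarCurve (hpos : ∀ t, 0 < s t) (t : ℝ) : ‖polarCurve s J t‖ ^ 2 = s t := by
  rw [norm_polarCurve, Real.sq_sqrt (hpos t).le]

theorem polarCurve_ne_zero (hpos : ∀ t, 0 < s t) (t : ℝ) : polarCurve s J t ≠ 0 := by
  rw [← norm_pos_iff, norm_polarCurve]
  exact Real.sqrt_pos.2 (hpos t)

theorem hasDerivAt_angle (hs : Continuous s) (hpos : ∀ t, 0 < s t) (t : ℝ) :
    HasDerivAt (fun t => ∫ τ in (0 : ℝ)..t, J / s τ) (J / s t) t := by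
  have hc : Continuous fun τ => J / s τ := continuous_const.div hs fun t => (hpos t).ne'
  exact intervalIntegral.integral_hasDerivAt_right (hc.intervalIntegrable _ _)
    (hc.stronglyMeasurableAtFilter _ _) hc.continuousAt

theorem contDiff_polarCurve (hs : ContDiff ℝ ∞ s) (hpos : ∀ t, 0 < s t) :
    ContDiff ℝ ∞ (polarCurve s J) := by
  have hθ : ContDiff ℝ ∞ fun t => ∫ τ in (0 : ℝ)..t, J / s τ := by
    rw [contDiff_infty_iff_deriv]
    refine ⟨fun t => (hasDerivAt_angle hs.continuous hpos t).differentiableAt, ?_⟩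
    rw [show deriv (fun t => ∫ τ in (0 : ℝ)..t, J / s τ) = fun t => J / s t from
      funext fun t => (hasDerivAt_angle hs.continuous hpos t).deriv]
    exact contDiff_const.div hs fun t => (hpos t).ne'
  have h1 : ContDiff ℝ ∞ fun t => ((√(s t) : ℝ) : ℂ) :=
    Complex.ofRealCLM.contDiff.comp (hs.sqrt fun t => (hpos t).ne')
  have h2 : ContDiff ℝ ∞ fun t => (((∫ τ in (0 : ℝ)..t, J / s τ) : ℝ) : ℂ) :=
    Complex.ofRealCLM.contDiff.comp hθ
  exact h1.mul ((h2.mul contDiff_const).cexp)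

variable {p g : ℝ → ℝ}

theorem hasDerivAt_polarCurve (hp : ∀ t, HasDerivAt s (p t) t) (hpos : ∀ t, 0 < s t) (t : ℝ) :
    HasDerivAt (polarCurve s J) (((p t / 2 : ℝ) + J * Complex.I) / s t * polarCurve s J t) t := by
  have hc : Continuous s := continuous_iff_continuousAt.2 fun t => (hp t).continuousAt
  have h1 := ((hp t).sqrt (hpos t).ne').ofReal_comp
  have h2 := (((hasDerivAt_angle (J := J) hc hpos t).ofReal_comp).mul_const Complex.I).cexp
  refine (h1.mul h2).congr_deriv ?_
  have hsq : ((√(s t) : ℝ) : ℂ) ^ 2 = s t := by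
    rw [← Complex.ofReal_pow, Real.sq_sqrt (hpos t).le]
  have hne : ((√(s t) : ℝ) : ℂ) ≠ 0 := Complex.ofReal_ne_zero.2 (Real.sqrt_pos.2 (hpos t)).ne'
  have hpt : polarCurve s J t =
    (√(s t) : ℝ) * Complex.exp ((∫ τ in (0 : ℝ)..t, J / s τ : ℝ) * Complex.I) := rfl
  rw [hpt, Complex.ofReal_div, Complex.ofReal_div, Complex.ofReal_mul]
  rw [← hsq]
  push_cast
  field_simp

theorem norm_sq_deriv_polarCurve (hp : ∀ t, HasDerivAt s (p t) t) (hpos : ∀ t, 0 < s t) (t : ℝ) :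
    ‖deriv (polarCurve s J) t‖ ^ 2 = (p t ^ 2 / 4 + J ^ 2) / s t := by
  have h := (hpos t).ne'
  rw [(hasDerivAt_polarCurve hp hpos t).deriv, norm_mul, mul_pow, norm_sq_polarCurve hpos,
    norm_div, div_pow, Complex.sq_norm, Complex.normSq_add_mul_I, Complex.norm_real,
    Real.norm_eq_abs, sq_abs]
  field_simp
  ring

theorem deriv_deriv_polarCurve (hp : ∀ t, HasDerivAt s (p t) t) (hg : ∀ t, HasDerivAt p (g t) t)
    (hpos : ∀ t, 0 < s t) (t : ℝ) :
    deriv (deriv (polarCurve s J)) t =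
      (g t / (2 * s t) - (J ^ 2 + p t ^ 2 / 4) / s t ^ 2) • polarCurve s J t := by
  have h := (hpos t).ne'
  have h' : (s t : ℂ) ≠ 0 := Complex.ofReal_ne_zero.2 h
  rw [show deriv (polarCurve s J) = fun t => ((p t / 2 : ℝ) + J * Complex.I) / s t *
    polarCurve s J t from funext fun t => (hasDerivAt_polarCurve hp hpos t).deriv]
  have h1 := (((hg t).div_const 2).ofReal_comp).add_const (J * Complex.I)
  have h2 := (h1.div (hp t).ofReal_comp h').mul (hasDerivAt_polarCurve (J := J) hp hpos t)
  refine (h2.deriv).trans ?_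
  rw [Complex.real_smul, Pi.div_apply]
  push_cast
  have hI := Complex.I_sq
  field_simp
  linear_combination (16 * J ^ 2 * polarCurve s J t) * hI

theorem constantArgument_polarCurve_zero : ConstantArgument (polarCurve s 0) := by
  have : ∀ t, (polarCurve s 0 t).arg = 0 := fun t => by
    simp [polarCurve, Complex.arg_ofReal_of_nonneg (Real.sqrt_nonneg _)]
  intro t t'
  rw [this, this]

/-- A constant argument would make the logarithmic derivative real, but its imaginary part is `J /
s`. -/
theorem not_constantArgument_polarCurve (hp : ∀ t, HasDerivAt s (p t) t) (hpos : ∀ t, 0 < s t)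
    (hJ : J ≠ 0) : ¬ ConstantArgument (polarCurve s J) := by
  intro hconst
  set α := (polarCurve s J 0).arg
  have h1 : ∀ t, polarCurve s J t = (√(s t) : ℝ) * Complex.exp (α * Complex.I) := fun t => by
    have hα : (polarCurve s J t).arg = α := hconst t 0
    rw [← hα, ← norm_polarCurve (J := J), Complex.norm_mul_exp_arg_mul_I]
  have h2 : HasDerivAt (polarCurve s J) _ 0 :=
    ((((hp 0).sqrt (hpos 0).ne').ofReal_comp).mul_const
      (Complex.exp (α * Complex.I))).congr_of_eventuallyEq (Filter.Eventually.of_forall h1)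
  have h3 := h2.unique (hasDerivAt_polarCurve hp hpos 0)
  rw [h1 0, ← mul_assoc] at h3
  have h4 := mul_right_cancel₀ (Complex.exp_ne_zero _) h3
  have h5 := congrArg Complex.im h4
  rw [Complex.ofReal_im, Complex.im_mul_ofReal, Complex.div_ofReal_im] at h5
  simp at h5
  have h6 := (Real.sqrt_pos.2 (hpos 0)).ne'
  have h7 := (hpos 0).ne'
  simp [hJ, h6, h7] at h5

end PolarCurve

/-! ### Global integral curves. -/

section GlobalFlow

/-- A bounded Lipschitz vector field has global integral curves. -/
theorem exists_global_integralCurve {E : Type*} [NormedAddCommGroup E] [NormedSpace ℝ E]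
    [CompleteSpace E] {v : E → E} {K L : NNReal} (hK : LipschitzWith K v) (hL : ∀ x, ‖v x‖ ≤ L)
    (x₀ : E) : ∃ y : ℝ → E, y 0 = x₀ ∧ ∀ t, HasDerivAt y (v (y t)) t := by
  have hloc : ∀ T : ℝ, 0 < T → ∃ y : ℝ → E, y 0 = x₀ ∧
      ∀ t ∈ Set.Ioo (-T) T, HasDerivAt y (v (y t)) t := by
    intro T hT
    -- Since `v` is bounded by `L`, a ball of radius `L T` contains everything reached up to time
    -- `T`, so Picard–Lindelöf applies on every interval; uniqueness then glues the solutions.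
    have hpl : IsPicardLindelof (fun _ : ℝ => v) (tmin := -T) (tmax := T)
        ⟨0, by constructor <;> linarith⟩ x₀ (L * T.toNNReal) 0 L K := by
      refine ⟨fun t _ => hK.lipschitzOnWith, fun x _ => continuousOn_const, fun t _ x _ => hL x, ?_⟩
      simp [Real.coe_toNNReal T hT.le]
    obtain ⟨y, hy0, hy⟩ := hpl.exists_eq_forall_mem_Icc_hasDerivWithinAt₀
    exact ⟨y, hy0, fun t ht => (hy t (Set.Ioo_subset_Icc_self ht)).hasDerivAt
      (Icc_mem_nhds ht.1 ht.2)⟩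
  choose! Y hY0 hY using hloc
  have huniq : ∀ T T' t : ℝ, 0 < T → T ≤ T' → t ∈ Set.Ioo (-T) T → Y T t = Y T' t := by
    intro T T' t hT hTT ht
    have hsub : Set.Ioo (-T) T ⊆ Set.Ioo (-T') T' := Set.Ioo_subset_Ioo (by linarith) hTT
    exact ODE_solution_unique_of_mem_Ioo (v := fun _ => v) (s := fun _ => Set.univ) (t₀ := 0)
      (fun _ _ => hK.lipschitzOnWith) ⟨by linarith, hT⟩
      (fun s hs => ⟨hY T hT s hs, trivial⟩)
      (fun s hs => ⟨hY T' (by linarith) s (hsub hs), trivial⟩)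
      (by rw [hY0 T hT, hY0 T' (by linarith)]) ht
  refine ⟨fun t => Y (|t| + 1) t, hY0 _ (by positivity), fun t => ?_⟩
  have hpos : 0 < |t| + 1 := by positivity
  have ht : t ∈ Set.Ioo (-(|t| + 1)) (|t| + 1) := abs_lt.1 (lt_add_one _)
  refine (hY _ hpos t ht).congr_of_eventuallyEq ?_
  filter_upwards [isOpen_Ioo.mem_nhds ht] with s hs
  rcases le_total (|s| + 1) (|t| + 1) with h | h
  · exact huniq _ _ s (by positivity) h (abs_lt.1 (lt_add_one _))
  · exact (huniq _ _ s hpos h hs).symm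

end GlobalFlow

/-! ### Motion of a particle in a one-dimensional potential. -/

section OneDimensional

/-- A particle on the line which starts at rest at the lower turning point `r₀` of a potential well
stays between `r₀` and any further point where the energy is not sufficient. -/
theorem exists_oscillation {Φ Φ' : ℝ → ℝ} (hΦ : ∀ x, HasDerivAt Φ (Φ' x) x)
    (hΦ' : ContDiff ℝ ∞ Φ') {r₀ x₁ : ℝ} (hlt : r₀ < x₁) (h0 : Φ r₀ = 0) (h0' : 0 < Φ' r₀)
    (h1 : Φ x₁ < 0) :
    ∃ r p : ℝ → ℝ, (∀ t, HasDerivAt r (p t) t) ∧ (∀ t, HasDerivAt p (2 * Φ' (r t)) t) ∧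
      (∀ t, p t ^ 2 = 4 * Φ (r t)) ∧ r 0 = r₀ ∧ ∀ t, r₀ ≤ r t ∧ r t < x₁ := by
  have hcΦ : Continuous Φ := continuous_iff_continuousAt.2 fun x => (hΦ x).continuousAt
  obtain ⟨B, hB⟩ := isCompact_Icc.exists_bound_of_continuousOn
    (hcΦ.continuousOn (s := Set.Icc r₀ x₁))
  let R : ℝ := |r₀| + |x₁| + 4 * |B| + 1
  have hR : 0 < R := by positivity
  -- Cutting off the Hamiltonian field makes it bounded and Lipschitz; `R` is large enough that the
  -- orbit never sees the cutoff.
  let χ : ContDiffBump (0 : ℝ × ℝ) := ⟨R, R + 1, hR, by linarith⟩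
  let w : ℝ × ℝ → ℝ × ℝ := fun y => χ y • (y.2, 2 * Φ' y.1)
  have hw : ContDiff ℝ ∞ w := by
    have h1 : ContDiff ℝ ∞ fun y : ℝ × ℝ => (y.2, 2 * Φ' y.1) :=
      contDiff_snd.prodMk (contDiff_const.mul (hΦ'.comp contDiff_fst))
    exact χ.contDiff.smul h1
  have hsupp : HasCompactSupport w := χ.hasCompactSupport.smul_right
  obtain ⟨K, hK⟩ := ContDiff.lipschitzWith_of_hasCompactSupport hsupp hw (by simp)
  obtain ⟨C, hC⟩ := hsupp.exists_bound_of_continuous hw.continuous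
  obtain ⟨y, hy0, hy⟩ := exists_global_integralCurve hK (L := C.toNNReal)
    (fun x => (hC x).trans (Real.le_coe_toNNReal C)) (r₀, 0)
  have hr : ∀ t, HasDerivAt (fun t => (y t).1) (χ (y t) * (y t).2) t := fun t =>
    (hasFDerivAt_fst (𝕜 := ℝ) (E := ℝ) (F := ℝ) (p := y t)).comp_hasDerivAt t (hy t)
  have hp : ∀ t, HasDerivAt (fun t => (y t).2) (χ (y t) * (2 * Φ' (y t).1)) t := fun t =>
    (hasFDerivAt_snd (𝕜 := ℝ) (E := ℝ) (F := ℝ) (p := y t)).comp_hasDerivAt t (hy t)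
  have hcr : Continuous fun t => (y t).1 :=
    continuous_iff_continuousAt.2 fun t => (hr t).continuousAt
  -- The cutoff multiplies both components of the field by the same factor, so energy is conserved
  -- even before the cutoff is known to be inactive.
  have henergy : ∀ t, (y t).2 ^ 2 = 4 * Φ (y t).1 := by
    have hd : ∀ t, HasDerivAt (fun t => (y t).2 ^ 2 - 4 * Φ (y t).1) 0 t := fun t =>
      (((hp t).pow 2).sub (((hΦ _).comp t (hr t)).const_mul 4)).congr_deriv (by
        simp only [Nat.cast_ofNat]; ring)
    intro t
    have h := is_const_of_deriv_eq_zero (fun t => (hd t).differentiableAt)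
      (fun t => (hd t).deriv) t 0
    simp only [hy0, h0] at h
    linarith
  have hnonneg : ∀ t, 0 ≤ Φ (y t).1 := fun t => by nlinarith [henergy t, sq_nonneg (y t).2]
  -- The values of `r` form an interval containing `r₀` and lie in `Φ ≥ 0`, so they cannot pass a
  -- point where `Φ < 0`.
  have havoid : ∀ x t, Φ x < 0 → (x < r₀ → x < (y t).1) ∧ (r₀ < x → (y t).1 < x) := by
    intro x t hx
    have hrange : Set.OrdConnected (Set.range fun t => (y t).1) :=
      (isPreconnected_range hcr).ordConnected
    have hnot : x ∉ Set.range fun t => (y t).1 := by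
      rintro ⟨s, rfl⟩
      exact absurd (hnonneg s) (not_le.2 hx)
    have h0 : r₀ ∈ Set.range fun t => (y t).1 := ⟨0, by simp [hy0]⟩
    constructor
    · intro h
      by_contra! hc
      exact hnot (hrange.out ⟨t, rfl⟩ h0 ⟨hc, h.le⟩)
    · intro h
      by_contra! hc
      exact hnot (hrange.out h0 ⟨t, rfl⟩ ⟨h.le, hc⟩)
  have hupper : ∀ t, (y t).1 < x₁ := fun t => (havoid x₁ t h1).2 hlt
  have hlower : ∀ t, r₀ ≤ (y t).1 := by
    intro t
    by_contra! hc
    -- As `Φ r₀ = 0` and `Φ' r₀ > 0`, there are barriers arbitrarily close to the left of `r₀`.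
    have hev : ∀ᶠ x in nhdsWithin r₀ (Set.Iio r₀), Φ x < 0 := by
      have := (hasDerivAt_iff_tendsto_slope_left_right.1 (hΦ r₀)).1.eventually (lt_mem_nhds h0')
      filter_upwards [this, self_mem_nhdsWithin] with x hx hxlt
      rw [slope_def_field, h0, div_pos_iff] at hx
      simp only [Set.mem_Iio] at hxlt
      rcases hx with h | h <;> linarith [h.1, h.2]
    obtain ⟨x, hx, hx'⟩ := (hev.and (Ioo_mem_nhdsLT hc)).exists
    exact absurd ((havoid x t hx).1 hx'.2) (not_lt.2 hx'.1.le)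
  have hχ : ∀ t, χ (y t) = 1 := by
    intro t
    refine χ.one_of_mem_closedBall ?_
    have hb := hB (y t).1 ⟨hlower t, (hupper t).le⟩
    rw [Real.norm_eq_abs, abs_le] at hb
    rw [mem_closedBall_zero_iff, Prod.norm_def, max_le_iff, Real.norm_eq_abs, Real.norm_eq_abs]
    have hBB := le_abs_self B
    change _ ≤ R ∧ _ ≤ R
    have := abs_nonneg r₀
    have := abs_nonneg x₁
    have := abs_nonneg B
    constructor
    · rw [abs_le]
      have := neg_abs_le r₀
      have := le_abs_self x₁
      constructor <;> simp only [R] <;> linarith [hlower t, hupper t]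
    -- The momentum is bounded through the energy and `2 |p| ≤ p² + 1`.
    · have h4 : |(y t).2| ^ 2 ≤ 4 * |B| := by rw [sq_abs, henergy]; linarith
      simp only [R]
      nlinarith [sq_nonneg (|(y t).2| - 1)]
  refine ⟨fun t => (y t).1, fun t => (y t).2, fun t => ?_, fun t => ?_, henergy, by simp [hy0],
    fun t => ⟨hlower t, hupper t⟩⟩
  · simpa [hχ] using hr t
  · simpa [hχ] using hp t

/-- Regularity of the solutions of a smooth second order equation. -/
theorem contDiff_of_hasDerivAt_of_hasDerivAt {r p G : ℝ → ℝ} (hG : ContDiff ℝ ∞ G)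
    (hr : ∀ t, HasDerivAt r (p t) t) (hp : ∀ t, HasDerivAt p (G (r t)) t) : ContDiff ℝ ∞ r := by
  have hr' : deriv r = p := funext fun t => (hr t).deriv
  have hp' : deriv p = G ∘ r := funext fun t => (hp t).deriv
  have key : ∀ n : ℕ, ContDiff ℝ n r ∧ ContDiff ℝ n p := by
    intro n
    induction n with
    | zero =>
      simp only [Nat.cast_zero, contDiff_zero]
      exact ⟨continuous_iff_continuousAt.2 fun t => (hr t).continuousAt,
        continuous_iff_continuousAt.2 fun t => (hp t).continuousAt⟩
    | succ n ih =>
      push_cast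
      rw [contDiff_succ_iff_deriv, contDiff_succ_iff_deriv, hr', hp']
      refine ⟨⟨fun t => (hr t).differentiableAt, by simp, ih.2⟩,
        fun t => (hp t).differentiableAt, by simp, ?_⟩
      exact (contDiff_infty.1 hG n).comp ih.1
  exact contDiff_infty.2 fun n => (key n).1

end OneDimensional

/-! ### Generating curves from solutions of the reduced equation. -/

section SpiralCurve

/-- The curve in `S³` with squared first magnitude `r` and angular momenta `J₁`, `J₂`. -/
def spiralCurve (r : ℝ → ℝ) (J₁ J₂ : ℝ) (t : ℝ) : ℂ × ℂ :=
  (polarCurve r J₁ t, polarCurve (fun t => 1 - r t) J₂ t)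

/-- The effective potential: `(r')² = 4 Φ(r)` holds for the squared first magnitude `r` of the
geodesics with angular momenta `J₁`, `J₂` in the weighted metric. -/
def effectivePotential (k₁ k₂ : ℕ) (J₁ J₂ x : ℝ) : ℝ :=
  x ^ (k₁ + 1) * (1 - x) ^ (k₂ + 1) - J₁ ^ 2 * (1 - x) - J₂ ^ 2 * x

/-- The derivative of the effective potential. -/
def effectiveForce (k₁ k₂ : ℕ) (J₁ J₂ x : ℝ) : ℝ :=
  x ^ k₁ * (1 - x) ^ k₂ * ((k₁ + 1) * (1 - x) - (k₂ + 1) * x) + J₁ ^ 2 - J₂ ^ 2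

variable {k₁ k₂ : ℕ} {J₁ J₂ : ℝ}

theorem hasDerivAt_effectivePotential (x : ℝ) :
    HasDerivAt (effectivePotential k₁ k₂ J₁ J₂) (effectiveForce k₁ k₂ J₁ J₂ x) x := by
  have h1 : HasDerivAt (fun x : ℝ => 1 - x) (-1) x := by
    simpa using (hasDerivAt_id x).const_sub 1
  have h := (((hasDerivAt_pow (k₁ + 1) x).mul (h1.pow (k₂ + 1))).sub
    (h1.const_mul (J₁ ^ 2))).sub ((hasDerivAt_id x).const_mul (J₂ ^ 2))
  refine h.congr_deriv ?_
  simp only [effectiveForce, Nat.add_sub_cancel, Pi.pow_apply]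
  push_cast
  ring

theorem contDiff_effectiveForce : ContDiff ℝ ∞ (effectiveForce k₁ k₂ J₁ J₂) := by
  unfold effectiveForce
  fun_prop

variable {r p : ℝ → ℝ}

theorem tendsto_integral_atTop_of_le {f : ℝ → ℝ} (hf : Continuous f) {m : ℝ} (hm : 0 < m)
    (hle : ∀ t, m ≤ f t) :
    Filter.Tendsto (fun T => ∫ t in (0 : ℝ)..T, f t) Filter.atTop Filter.atTop ∧
      Filter.Tendsto (fun T => ∫ t in (-T)..(0 : ℝ), f t) Filter.atTop Filter.atTop := by
  have key : ∀ a b : ℝ, a ≤ b → m * (b - a) ≤ ∫ t in a..b, f t := by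
    intro a b hab
    have := intervalIntegral.integral_mono_on hab (intervalIntegrable_const (c := m) (μ := MeasureTheory.volume))
      (hf.intervalIntegrable a b) (fun t _ => hle t)
    simpa [mul_comm] using this
  have hlin : Filter.Tendsto (fun T : ℝ => m * T) Filter.atTop Filter.atTop :=
    Filter.tendsto_id.const_mul_atTop hm
  constructor <;> refine Filter.tendsto_atTop_mono' _ ?_ hlin <;>
    filter_upwards [Filter.eventually_ge_atTop (0 : ℝ)] with T hT
  · simpa using key 0 T hT
  · simpa using key (-T) 0 (by linarith)

section

variable (hr : ∀ t, HasDerivAt r (p t) t)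
  (hp : ∀ t, HasDerivAt p (2 * effectiveForce k₁ k₂ J₁ J₂ (r t)) t)
  (henergy : ∀ t, p t ^ 2 = 4 * effectivePotential k₁ k₂ J₁ J₂ (r t))
  (hr0 : ∀ t, 0 < r t) (hr1 : ∀ t, r t < 1)

include hr henergy hr0 hr1 in
-- The energy equation is exactly the statement that the squared speed equals the weight.
theorem speed_sq_spiralCurve (t : ℝ) :
    ‖deriv (polarCurve r J₁) t‖ ^ 2 + ‖deriv (polarCurve (fun t => 1 - r t) J₂) t‖ ^ 2 =
      r t ^ k₁ * (1 - r t) ^ k₂ := by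
  have hpos : ∀ t, 0 < 1 - r t := fun t => sub_pos.2 (hr1 t)
  have h1 := (hr0 t).ne'
  have h2 := (hpos t).ne'
  rw [norm_sq_deriv_polarCurve hr hr0,
    norm_sq_deriv_polarCurve (fun t => (hr t).const_sub 1) hpos, neg_sq, henergy,
    effectivePotential]
  field_simp
  ring

include hr hr0 hr1 in
-- Both squared magnitudes are below `1`, so the angular parts alone give this bound. It yields
-- immersedness and infinite length.
theorem le_speed_sq_spiralCurve (t : ℝ) : J₁ ^ 2 + J₂ ^ 2 ≤
    ‖deriv (polarCurve r J₁) t‖ ^ 2 + ‖deriv (polarCurve (fun t => 1 - r t) J₂) t‖ ^ 2 := by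
  have hpos : ∀ t, 0 < 1 - r t := fun t => sub_pos.2 (hr1 t)
  rw [norm_sq_deriv_polarCurve hr hr0, norm_sq_deriv_polarCurve (fun t => (hr t).const_sub 1) hpos]
  refine add_le_add ?_ ?_
  · rw [le_div_iff₀ (hr0 t)]
    nlinarith [sq_nonneg (p t), sq_nonneg J₁, hr0 t, hr1 t]
  · rw [le_div_iff₀ (hpos t)]
    nlinarith [sq_nonneg (p t), sq_nonneg J₂, hr0 t, hr1 t]

variable {m₁ m₂ : ℕ}
  {M₁ : Type*} [TopologicalSpace M₁] [ChartedSpace (EuclideanSpace ℝ (Fin k₁)) M₁]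
  {M₂ : Type*} [TopologicalSpace M₂] [ChartedSpace (EuclideanSpace ℝ (Fin k₂)) M₂]
  {f₁ : M₁ → EuclideanSpace ℂ (Fin (m₁ + 1))} {f₂ : M₂ → EuclideanSpace ℂ (Fin (m₂ + 1))}
  (hf₁ : IsMinimalSphericalImmersion (𝓡 k₁) f₁) (hf₂ : IsMinimalSphericalImmersion (𝓡 k₂) f₂)
  (hr₁ : IsCTotallyReal (𝓡 k₁) f₁) (hr₂ : IsCTotallyReal (𝓡 k₂) f₂)

include hr hp henergy hr0 hr1 hf₁ hf₂ hr₁ hr₂ in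
theorem generatesSpiralMinimalProduct_spiralCurve (hJ : 0 < J₁ ^ 2 + J₂ ^ 2) :
    GeneratesSpiralMinimalProduct k₁ k₂ f₁ f₂ (spiralCurve r J₁ J₂) := by
  have hpos : ∀ t, 0 < 1 - r t := fun t => sub_pos.2 (hr1 t)
  have hr' : ∀ t, HasDerivAt (fun t => 1 - r t) (-p t) t := fun t => (hr t).const_sub 1
  have hp' : ∀ t, HasDerivAt (fun t => -p t) (-(2 * effectiveForce k₁ k₂ J₁ J₂ (r t))) t :=
    fun t => (hp t).neg
  have hsmooth : ContDiff ℝ ∞ r :=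
    contDiff_of_hasDerivAt_of_hasDerivAt (contDiff_const.mul contDiff_effectiveForce) hr hp
  have hs₁ : ContDiff ℝ ∞ (polarCurve r J₁) := contDiff_polarCurve hsmooth hr0
  have hs₂ : ContDiff ℝ ∞ (polarCurve (fun t => 1 - r t) J₂) :=
    contDiff_polarCurve (contDiff_const.sub hsmooth) hpos
  have hsphere : ∀ t, ‖polarCurve r J₁ t‖ ^ 2 + ‖polarCurve (fun t => 1 - r t) J₂ t‖ ^ 2 = 1 := by
    intro t
    rw [norm_sq_polarCurve hr0, norm_sq_polarCurve hpos]
    ring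
  have hspeed := speed_sq_spiralCurve hr henergy hr0 hr1
  have hle := le_speed_sq_spiralCurve (J₁ := J₁) (J₂ := J₂) hr hr0 hr1
  have hd := fun t => hJ.trans_le (hle t)
  have hderiv : ∀ t, deriv (spiralCurve r J₁ J₂) t =
      (deriv (polarCurve r J₁) t, deriv (polarCurve (fun t => 1 - r t) J₂) t) := fun t =>
    ((hs₁.differentiable (by simp) t).hasDerivAt.prodMk
      (hs₂.differentiable (by simp) t).hasDerivAt).deriv
  have hsm : ContDiff ℝ ∞ (spiralCurve r J₁ J₂) := hs₁.prodMk hs₂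
  have hspd : ∀ t, √(J₁ ^ 2 + J₂ ^ 2) ≤ speed (spiralCurve r J₁ J₂) t := fun t => by
    rw [speed, hderiv]
    exact Real.sqrt_le_sqrt (hle t)
  have hcspeed : Continuous (speed (spiralCurve r J₁ J₂)) := by
    have := hsm.continuous_deriv (by simp)
    unfold speed
    fun_prop
  have hlength := tendsto_integral_atTop_of_le hcspeed (Real.sqrt_pos.2 hJ) hspd
  refine ⟨⟨hsm, hsphere, fun t h0 => ?_, polarCurve_ne_zero hr0, polarCurve_ne_zero hpos,
    hlength.1, hlength.2⟩, ?_⟩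
  · rw [hderiv, Prod.mk_eq_zero] at h0
    have := hd t
    simp [h0.1, h0.2] at this
  -- The constant `c = k₁ + k₂ + 1` is forced by differentiating `|γ₁|² + |γ₂|² = 1` twice.
  · refine isMinimalSphericalImmersion_gammaProduct hf₁ hf₂ hr₁ hr₂ hs₁ hs₂ hsphere hd
      (polarCurve_ne_zero hr0) (polarCurve_ne_zero hpos) (k₁ + k₂ + 1) (fun t => ?_) (fun t => ?_)
    · rw [deriv_deriv_polarCurve hr hp hr0, norm_sq_polarCurve hr0, hspeed, henergy]
      congr 1
      have h1 := (hr0 t).ne'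
      rw [effectivePotential, effectiveForce]
      field_simp
      ring
    · rw [deriv_deriv_polarCurve hr' hp' hpos, norm_sq_polarCurve hpos, hspeed, neg_sq, henergy]
      congr 1
      have h1 := (hpos t).ne'
      rw [effectivePotential, effectiveForce]
      field_simp
      ring

end

end SpiralCurve

/-! ### A congruence invariant. -/

section Congruence

/-- Linear isometries of the factors preserve magnitudes, and the set of values depends only on the
trace. -/
theorem CongruentCurves.range_norm_sq_fst_eq {γ γ' : ℝ → ℂ × ℂ} (h : CongruentCurves γ γ') :
    (Set.range fun t => ‖(γ t).1‖ ^ 2) = Set.range fun t => ‖(γ' t).1‖ ^ 2 := by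
  obtain ⟨A, B, hAB⟩ := h
  have h1 := congrArg (fun s => (fun z : ℂ × ℂ => ‖z.1‖ ^ 2) '' s) hAB
  simp only [← Set.range_comp] at h1
  simpa [Function.comp_def] using h1

/-- A family of curves parametrized by the minimum of the first magnitude is uncountable up to
congruence. -/
theorem uncountablyManyCurves_of_isLeast {P : (ℝ → ℂ × ℂ) → Prop} {a b : ℝ} (hab : a < b)
    (h : ∀ x ∈ Set.Ioo a b, ∃ γ, P γ ∧ IsLeast (Set.range fun t => ‖(γ t).1‖ ^ 2) x) :
    UncountablyManyCurves P := by
  choose! Γ hP hΓ using h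
  have hinj : Set.InjOn Γ (Set.Ioo a b) := fun x hx y hy hxy =>
    (hΓ x hx).unique (hxy ▸ hΓ y hy)
  refine ⟨Γ '' Set.Ioo a b, fun hc => ?_, ?_, ?_⟩
  · exact (Cardinal.Real.Ioo_countable_iff.1
      (Set.countable_of_injective_of_countable_image hinj hc)).not_gt hab
  · rintro _ ⟨x, hx, rfl⟩
    exact hP x hx
  · rintro _ ⟨x, hx, rfl⟩ _ ⟨y, hy, rfl⟩ hne hcong
    have hx' := hΓ x hx
    rw [hcong.range_norm_sq_fst_eq] at hx'
    exact hne (by rw [hx'.unique (hΓ y hy)])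

end Congruence

/-! ### Initial data at a turning point. -/

section Initial

variable {k₁ k₂ : ℕ} {r₀ u J₁ J₂ : ℝ}

/-- At a point with `r' = 0` the component speeds squared are `J₁² / r₀` and `J₂² / (1 - r₀)`; the
hypotheses split the weight between them in the proportion `u : 1 - u`. -/
theorem effectivePotential_eq_zero
    (hJ₁ : J₁ ^ 2 = u * (r₀ ^ k₁ * (1 - r₀) ^ k₂) * r₀)
    (hJ₂ : J₂ ^ 2 = (1 - u) * (r₀ ^ k₁ * (1 - r₀) ^ k₂) * (1 - r₀)) :
    effectivePotential k₁ k₂ J₁ J₂ r₀ = 0 := by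
  rw [effectivePotential, hJ₁, hJ₂]
  ring

theorem effectiveForce_eq
    (hJ₁ : J₁ ^ 2 = u * (r₀ ^ k₁ * (1 - r₀) ^ k₂) * r₀)
    (hJ₂ : J₂ ^ 2 = (1 - u) * (r₀ ^ k₁ * (1 - r₀) ^ k₂) * (1 - r₀)) :
    effectiveForce k₁ k₂ J₁ J₂ r₀ =
      r₀ ^ k₁ * (1 - r₀) ^ k₂ * ((u + k₁) - (k₁ + k₂ + 1) * r₀) := by
  rw [effectiveForce, hJ₁, hJ₂]
  ring

/-- The energy does not suffice to reach `x = 1` if `J₂ ≠ 0`, or if `J₁ ≠ 0` and `k₂ ≥ 1`. -/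
theorem exists_effectivePotential_neg (hr₀ : r₀ < 1) (h : J₂ ≠ 0 ∨ (J₁ ≠ 0 ∧ 1 ≤ k₂)) :
    ∃ x, r₀ < x ∧ x < 1 ∧ effectivePotential k₁ k₂ J₁ J₂ x < 0 := by
  by_cases hJ : J₂ = 0
  · obtain ⟨h1, h2⟩ := h.resolve_left (not_not.2 hJ)
    -- For `J₂ = 0` the potential vanishes at `1`, so the factor `1 - x` is split off; the other
    -- factor tends to `-J₁²` because `k₂ ≥ 1`.
    have hc : Filter.Tendsto (fun x : ℝ => x ^ (k₁ + 1) * (1 - x) ^ k₂ - J₁ ^ 2)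
        (nhdsWithin 1 (Set.Iio 1)) (nhds (-J₁ ^ 2)) := by
      have : Continuous fun x : ℝ => x ^ (k₁ + 1) * (1 - x) ^ k₂ - J₁ ^ 2 := by fun_prop
      have h3 := (this.tendsto 1).mono_left (nhdsWithin_le_nhds (s := Set.Iio 1))
      simpa [Nat.one_le_iff_ne_zero.1 h2] using h3
    have hneg : -J₁ ^ 2 < 0 := by
      have : 0 < J₁ ^ 2 := by positivity
      linarith
    obtain ⟨x, hx, hx'⟩ := ((hc.eventually (gt_mem_nhds hneg)).and (Ioo_mem_nhdsLT hr₀)).exists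
    refine ⟨x, hx'.1, hx'.2, ?_⟩
    have := mul_neg_of_pos_of_neg (sub_pos.2 hx'.2) hx
    rw [effectivePotential, hJ]
    calc _ = (1 - x) * (x ^ (k₁ + 1) * (1 - x) ^ k₂ - J₁ ^ 2) := by ring
      _ < 0 := this
  · have hcont : Continuous (effectivePotential k₁ k₂ J₁ J₂) :=
      continuous_iff_continuousAt.2 fun x => (hasDerivAt_effectivePotential x).continuousAt
    have h1 : effectivePotential k₁ k₂ J₁ J₂ 1 < 0 := by
      have : 0 < J₂ ^ 2 := by positivity
      simpa [effectivePotential] using this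
    have h3 := (hcont.tendsto 1).mono_left (nhdsWithin_le_nhds (s := Set.Iio 1))
    obtain ⟨x, hx, hx'⟩ := ((h3.eventually (gt_mem_nhds h1)).and (Ioo_mem_nhdsLT hr₀)).exists
    exact ⟨x, hx'.1, hx'.2, hx⟩

theorem exists_angularMomenta (hr0 : 0 < r₀) (hr1 : r₀ < 1) (hu : u ∈ Set.Icc (0 : ℝ) 1) :
    ∃ J₁ J₂ : ℝ, J₁ ^ 2 = u * (r₀ ^ k₁ * (1 - r₀) ^ k₂) * r₀ ∧
      J₂ ^ 2 = (1 - u) * (r₀ ^ k₁ * (1 - r₀) ^ k₂) * (1 - r₀) ∧ (J₁ = 0 ↔ u = 0) ∧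
      (J₂ = 0 ↔ u = 1) ∧ 0 < J₁ ^ 2 + J₂ ^ 2 := by
  have h1 : 0 < 1 - r₀ := sub_pos.2 hr1
  have hc : 0 < r₀ ^ k₁ * (1 - r₀) ^ k₂ := by positivity
  set c := r₀ ^ k₁ * (1 - r₀) ^ k₂
  have hu' : 0 ≤ 1 - u := sub_nonneg.2 hu.2
  have n1 : 0 ≤ u * c * r₀ := mul_nonneg (mul_nonneg hu.1 hc.le) hr0.le
  have n2 : 0 ≤ (1 - u) * c * (1 - r₀) := by positivity
  refine ⟨√(u * c * r₀), √((1 - u) * c * (1 - r₀)), Real.sq_sqrt n1, Real.sq_sqrt n2, ?_, ?_, ?_⟩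
  · rw [Real.sqrt_eq_zero n1]
    simp [hc.ne', hr0.ne']
  · rw [Real.sqrt_eq_zero n2]
    simp only [mul_eq_zero, hc.ne', h1.ne', or_false]
    rw [sub_eq_zero, eq_comm]
  · rw [Real.sq_sqrt n1, Real.sq_sqrt n2]
    rcases hu.1.eq_or_lt with h | h
    · rw [← h]; simp; positivity
    · have : 0 < u * c * r₀ := by positivity
      linarith

end Initial

/-! ### Steady and varying curves with prescribed minimum of `|γ₁|²`. -/

section Existence

variable {k₁ k₂ m₁ m₂ : ℕ}
  {M₁ : Type*} [TopologicalSpace M₁] [ChartedSpace (EuclideanSpace ℝ (Fin k₁)) M₁]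
  {M₂ : Type*} [TopologicalSpace M₂] [ChartedSpace (EuclideanSpace ℝ (Fin k₂)) M₂]
  {f₁ : M₁ → EuclideanSpace ℂ (Fin (m₁ + 1))} {f₂ : M₂ → EuclideanSpace ℂ (Fin (m₂ + 1))}

theorem constantArgument_polarCurve_iff {s p : ℝ → ℝ} {J : ℝ} (hp : ∀ t, HasDerivAt s (p t) t)
    (hpos : ∀ t, 0 < s t) : ConstantArgument (polarCurve s J) ↔ J = 0 :=
  ⟨fun h => not_not.1 fun hJ => not_constantArgument_polarCurve hp hpos hJ h,
    fun h => h ▸ constantArgument_polarCurve_zero⟩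

/-- Spiral minimal products of varying magnitudes; `u` is the initial share of the first component
in the squared speed. -/
theorem exists_varying_spiralCurve
    (hf₁ : IsMinimalSphericalImmersion (𝓡 k₁) f₁) (hf₂ : IsMinimalSphericalImmersion (𝓡 k₂) f₂)
    (hr₁ : IsCTotallyReal (𝓡 k₁) f₁) (hr₂ : IsCTotallyReal (𝓡 k₂) f₂)
    {r₀ u : ℝ} (hr0 : 0 < r₀) (hr1 : r₀ < 1) (hu : u ∈ Set.Icc (0 : ℝ) 1)
    (hk : u = 1 → 1 ≤ k₂) (hlt : (k₁ + k₂ + 1) * r₀ < u + k₁) :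
    ∃ γ, GeneratesSpiralMinimalProduct k₁ k₂ f₁ f₂ γ ∧
      (ConstantArgument (fun t => (γ t).1) ↔ u = 0) ∧
      (ConstantArgument (fun t => (γ t).2) ↔ u = 1) ∧ ¬ SteadyMagnitudes γ ∧
      IsLeast (Set.range fun t => ‖(γ t).1‖ ^ 2) r₀ := by
  obtain ⟨J₁, J₂, hJ₁, hJ₂, hz₁, hz₂, hJ⟩ :=
    exists_angularMomenta (k₁ := k₁) (k₂ := k₂) hr0 hr1 hu
  have h1 : 0 < 1 - r₀ := sub_pos.2 hr1
  have hforce : 0 < effectiveForce k₁ k₂ J₁ J₂ r₀ := by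
    rw [effectiveForce_eq hJ₁ hJ₂]
    have := sub_pos.2 hlt
    positivity
  obtain ⟨x₁, hx₀, hx₁, hneg⟩ : ∃ x, r₀ < x ∧ x < 1 ∧ effectivePotential k₁ k₂ J₁ J₂ x < 0 := by
    refine exists_effectivePotential_neg hr1 ?_
    by_cases h : u = 1
    · exact Or.inr ⟨fun h0 => by rw [hz₁, h] at h0; exact one_ne_zero h0, hk h⟩
    · exact Or.inl (mt hz₂.1 h)
  obtain ⟨r, p, hr, hp, henergy, hinit, hbd⟩ := exists_oscillation
    (hasDerivAt_effectivePotential (k₁ := k₁) (k₂ := k₂)) contDiff_effectiveForce hx₀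
    (effectivePotential_eq_zero hJ₁ hJ₂) hforce hneg
  have hpos0 : ∀ t, 0 < r t := fun t => hr0.trans_le (hbd t).1
  have hlt1 : ∀ t, r t < 1 := fun t => (hbd t).2.trans hx₁
  have hn : ∀ t, ‖(spiralCurve r J₁ J₂ t).1‖ ^ 2 = r t := norm_sq_polarCurve hpos0
  refine ⟨spiralCurve r J₁ J₂,
    generatesSpiralMinimalProduct_spiralCurve hr hp henergy hpos0 hlt1 hf₁ hf₂ hr₁ hr₂ hJ,
    (constantArgument_polarCurve_iff hr hpos0).trans hz₁,
    (constantArgument_polarCurve_iff (fun t => (hr t).const_sub 1)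
      (fun t => sub_pos.2 (hlt1 t))).trans hz₂, fun hst => ?_, ?_⟩
  -- A constant `r` would force `r'' = 2 Φ'(r₀) = 0`.
  · have hconst : ∀ t, r t = r₀ := fun t => by
      rw [← hn t, hst.1 t 0, hn, hinit]
    have hp0 : ∀ t, p t = 0 := fun t =>
      (hr t).unique ((hasDerivAt_const t r₀).congr_of_eventuallyEq
        (Filter.Eventually.of_forall hconst))
    have h2 := (hp 0).unique ((hasDerivAt_const (0 : ℝ) (0 : ℝ)).congr_of_eventuallyEq
      (Filter.Eventually.of_forall hp0))
    rw [hinit] at h2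
    linarith
  · simp only [hn]
    exact ⟨⟨0, hinit⟩, by rintro _ ⟨t, rfl⟩; exact (hbd t).1⟩

theorem exists_steady_spiralCurve
    (hf₁ : IsMinimalSphericalImmersion (𝓡 k₁) f₁) (hf₂ : IsMinimalSphericalImmersion (𝓡 k₂) f₂)
    (hr₁ : IsCTotallyReal (𝓡 k₁) f₁) (hr₂ : IsCTotallyReal (𝓡 k₂) f₂)
    {r₀ u : ℝ} (hr0 : 0 < r₀) (hr1 : r₀ < 1) (hu : u ∈ Set.Ioo (0 : ℝ) 1)
    (heq : (k₁ + k₂ + 1) * r₀ = u + k₁) :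
    ∃ γ, (GeneratesSpiralMinimalProduct k₁ k₂ f₁ f₂ γ ∧ DoublySpiral γ ∧ SteadyMagnitudes γ) ∧
      IsLeast (Set.range fun t => ‖(γ t).1‖ ^ 2) r₀ := by
  obtain ⟨J₁, J₂, hJ₁, hJ₂, hz₁, hz₂, hJ⟩ :=
    exists_angularMomenta (k₁ := k₁) (k₂ := k₂) hr0 hr1 (Set.Ioo_subset_Icc_self hu)
  have hr : ∀ t : ℝ, HasDerivAt (fun _ : ℝ => r₀) ((fun _ : ℝ => (0 : ℝ)) t) t :=
    fun t => hasDerivAt_const t r₀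
  have hforce : effectiveForce k₁ k₂ J₁ J₂ r₀ = 0 := by
    rw [effectiveForce_eq hJ₁ hJ₂, heq]
    ring
  refine ⟨spiralCurve (fun _ => r₀) J₁ J₂,
    ⟨generatesSpiralMinimalProduct_spiralCurve hr (fun t => ?_) (fun t => ?_) (fun _ => hr0)
      (fun _ => hr1) hf₁ hf₂ hr₁ hr₂ hJ,
    ⟨mt ((constantArgument_polarCurve_iff hr fun _ => hr0).trans hz₁).1 hu.1.ne',
      mt ((constantArgument_polarCurve_iff (fun t => (hr t).const_sub 1)
        fun _ => sub_pos.2 hr1).trans hz₂).1 hu.2.ne⟩,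
    fun t t' => ?_, fun t t' => ?_⟩, ?_⟩
  · rw [hforce, mul_zero]
    exact hasDerivAt_const t 0
  · simp [effectivePotential_eq_zero hJ₁ hJ₂]
  · simp [spiralCurve, norm_polarCurve]
  · simp [spiralCurve, norm_polarCurve]
  · have hn : ∀ t, ‖(spiralCurve (fun _ => r₀) J₁ J₂ t).1‖ ^ 2 = r₀ :=
      norm_sq_polarCurve fun _ => hr0
    simp only [hn, Set.range_const]
    exact isLeast_singleton

end Existence

end

/-! ### The three families. -/

theorem mainTheorem1 {k₁ k₂ m₁ m₂ : ℕ} (hk : 1 ≤ k₁ + k₂)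
    {M₁ : Type*} [TopologicalSpace M₁] [ChartedSpace (EuclideanSpace ℝ (Fin k₁)) M₁]
    [IsManifold (𝓡 k₁) ∞ M₁]
    {M₂ : Type*} [TopologicalSpace M₂] [ChartedSpace (EuclideanSpace ℝ (Fin k₂)) M₂]
    [IsManifold (𝓡 k₂) ∞ M₂]
    (f₁ : M₁ → EuclideanSpace ℂ (Fin (m₁ + 1))) (f₂ : M₂ → EuclideanSpace ℂ (Fin (m₂ + 1)))
    (hf₁ : IsMinimalSphericalImmersion (𝓡 k₁) f₁) (hf₂ : IsMinimalSphericalImmersion (𝓡 k₂) f₂)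
    (hr₁ : IsCTotallyReal (𝓡 k₁) f₁) (hr₂ : IsCTotallyReal (𝓡 k₂) f₂) :
    UncountablyManyCurves (fun γ =>
        GeneratesSpiralMinimalProduct k₁ k₂ f₁ f₂ γ ∧ DoublySpiral γ ∧ SteadyMagnitudes γ) ∧
      UncountablyManyCurves (fun γ =>
        GeneratesSpiralMinimalProduct k₁ k₂ f₁ f₂ γ ∧ DoublySpiral γ ∧ ¬ SteadyMagnitudes γ) ∧
      UncountablyManyCurves (fun γ =>
        GeneratesSpiralMinimalProduct k₁ k₂ f₁ f₂ γ ∧ SinglySpiral γ ∧ ¬ SteadyMagnitudes γ) := by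
  have hN : (0 : ℝ) < k₁ + k₂ + 1 := by positivity
  have c₁ : (0 : ℝ) ≤ k₁ := Nat.cast_nonneg k₁
  have c₂ : (0 : ℝ) ≤ k₂ := Nat.cast_nonneg k₂
  refine ⟨?_, ?_, ?_⟩
  -- The equilibrium condition determines `u = (k₁ + k₂ + 1) r₀ - k₁`, and the interval for `r₀`
  -- says that `0 < u < 1`.
  · refine uncountablyManyCurves_of_isLeast (a := k₁ / (k₁ + k₂ + 1))
      (b := (k₁ + 1) / (k₁ + k₂ + 1)) (by gcongr; linarith) fun r₀ hr₀ => ?_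
    have h1 := (div_lt_iff₀ hN).1 hr₀.1
    have h2 := (lt_div_iff₀ hN).1 hr₀.2
    have hr0 : 0 < r₀ := lt_of_le_of_lt (by positivity) hr₀.1
    have hr1 : r₀ < 1 := hr₀.2.trans_le (by rw [div_le_one hN]; linarith)
    exact exists_steady_spiralCurve hf₁ hf₂ hr₁ hr₂ hr0 hr1
      (u := (k₁ + k₂ + 1) * r₀ - k₁) ⟨by linarith, by linarith⟩ (by ring)
  -- Any fixed `u` strictly between `0` and `1` would do; the upper end of the interval is the
  -- equilibrium radius for `u = 1/2`.
  · refine uncountablyManyCurves_of_isLeast (a := 0) (b := (1 / 2 + k₁) / (k₁ + k₂ + 1))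
      (by positivity) fun r₀ hr₀ => ?_
    have h2 := (lt_div_iff₀ hN).1 hr₀.2
    have hr1 : r₀ < 1 := hr₀.2.trans_le (by rw [div_le_one hN]; linarith)
    obtain ⟨γ, hγ, ha₁, ha₂, hs, hl⟩ := exists_varying_spiralCurve hf₁ hf₂ hr₁ hr₂ hr₀.1 hr1
      (u := 1 / 2) (by norm_num) (by norm_num) (by linarith)
    exact ⟨γ, ⟨hγ, ⟨mt ha₁.1 (by norm_num), mt ha₂.1 (by norm_num)⟩, hs⟩, hl⟩
  -- For `k₂ = 0` the choice `u = 1` fails, as `Φ` is then positive between `r₀` and `1` and nothing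
  -- keeps `γ₂` from zero. There `u = 0` is used, whose equilibrium radius is positive since `k₁ ≥
  -- 1`.
  · rcases Nat.eq_zero_or_pos k₂ with hk₂ | hk₂
    · have hk₁ : (1 : ℝ) ≤ k₁ := by exact_mod_cast (show 1 ≤ k₁ by omega)
      refine uncountablyManyCurves_of_isLeast (a := 0) (b := k₁ / (k₁ + k₂ + 1))
        (by positivity) fun r₀ hr₀ => ?_
      have h2 := (lt_div_iff₀ hN).1 hr₀.2
      have hr1 : r₀ < 1 := hr₀.2.trans_le (by rw [div_le_one hN]; linarith)
      obtain ⟨γ, hγ, ha₁, ha₂, hs, hl⟩ := exists_varying_spiralCurve hf₁ hf₂ hr₁ hr₂ hr₀.1 hr1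
        (u := 0) (by norm_num) (by norm_num) (by linarith)
      exact ⟨γ, ⟨hγ, Or.inl ⟨ha₁.2 rfl, mt ha₂.1 (by norm_num)⟩, hs⟩, hl⟩
    · have hk₂' : (1 : ℝ) ≤ k₂ := by exact_mod_cast hk₂
      refine uncountablyManyCurves_of_isLeast (a := 0) (b := (1 + k₁) / (k₁ + k₂ + 1))
        (by positivity) fun r₀ hr₀ => ?_
      have h2 := (lt_div_iff₀ hN).1 hr₀.2
      have hr1 : r₀ < 1 := hr₀.2.trans_le (by rw [div_le_one hN]; linarith)
      obtain ⟨γ, hγ, ha₁, ha₂, hs, hl⟩ := exists_varying_spiralCurve hf₁ hf₂ hr₁ hr₂ hr₀.1 hr1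
        (u := 1) (by norm_num) (fun _ => hk₂) (by linarith)
      exact ⟨γ, ⟨hγ, Or.inr ⟨ha₂.2 rfl, mt ha₁.1 (by norm_num)⟩, hs⟩, hl⟩
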